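/- **Theorem.** Let $G$ be a finite simple graph. Then the following are equivalent: 1. $G$ is $(2P_3,C_4,C_6)$-free (that is, no induced subgraph of $G$ is isomorphic to $2P_3$, $C_4$ or $C_6$), and $G$ contains an induced $C_7$ or an induced $T_0$; 2. $G$ is a 7-saucer or a tent. The terms are as follows. $2P_3$ is the disjoint union of two three-vertex paths, and $C_k$ is the cycle on $k$ vertices. $T_0$ is the graph with vertices $a_0,a_1,b_0,b_1,b_2,b_3,c_1,c_2,c_3$ and edges $a_0a_1$, $a_0b_0,a_0b_2,a_0b_3$, $a_1b_1,a_1b_2,a_1b_3$, $c_1c_2,c_1c_3,c_2c_3$, $c_1b_0,c_1b_1,c_2b_2,c_3b_3$. The closed neighborhood of $v$ is $N_G[v]=\{v\}\cup N_G(v)$. Disjoint vertex sets $S,T$ are *complete* (*anticomplete*) to each other if every vertex of $S$ is adjacent (nonadjacent) to every vertex of $T$. Parts of a partition may be empty, and the empty set counts as a clique, unless stated otherwise. A set $S$ of vertices is *nested* if it can be ordered as $S=\{s_1,\dots,s_r\}$, $r\ge 0$, so that $N_G[s_r]\subseteq\dots\subseteq N_G[s_1]$. A *special partition* of a graph $H$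 is a partition $(X_0,\dots,X_6;Y_0,\dots,Y_6;Z_0,\dots,Z_6;W)$ of $V(H)$ into cliques such that for all $i\in\mathbb Z_7$ (indices in $\mathbb Z_7$): * $X_i\neq\emptyset$; * $X_i$ is complete to $X_{i-1},X_{i+1}$ and anticomplete to $X_{i+2},X_{i+3},X_{i+4},X_{i+5}$; * $X_i$ is complete to $Y_i,Y_{i+3},Y_{i+6},Z_i,Z_{i+3},Z_{i+4},Z_{i+5},Z_{i+6},W$ and anticomplete to $Y_{i+1},Y_{i+2},Y_{i+4},Y_{i+5},Z_{i+1},Z_{i+2}$; * if $Y_i\ne\emptyset$, then $Y_{i+1},Y_{i+2},Y_{i+5},Y_{i+6},Z_{i+5},Z_{i+6}$ are all empty, and at most one of $Y_{i+3},Y_{i+4}$ is nonempty; * if $Z_i\neq\emptyset$, then $Z_{i+2},Z_{i+5}$ are empty; * $Y_i$ is complete to $Y_{i+3},Y_{i+4},Z_i,Z_{i+1},Z_{i+3},Z_{i+4},W$ and anticomplete to $Z_{i+2}$; * $Z_i$ is complete to $Z_{i+1},Z_{i+3},Z_{i+4},Z_{i+6},W$. A *7-saucer* is a graph $G$ whose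 vertex set can be partitioned into sets $X_0,\dots,X_6,Y_0,\dots,Y_6,Z_0,\dots,Z_6,W,A$ such that: * $(X_0,\dots,X_6;Y_0,\dots,Y_6;Z_0,\dots,Z_6;W)$ is a special partition of $G\setminus A$; * $A$ is anticomplete to $X_0,\dots,X_6$; * for all $i\in\mathbb Z_7$, $A$ is anticomplete to $Y_i$ or $Z_{i+2}=\emptyset$; * $A$ is empty or can be partitioned into nonempty, pairwise anticomplete, nested cliques. A *tent* is a graph $G$ whose vertex set can be partitioned into sets $A_0,A_1,B_0,B_1,B_2,B_3,C_1,C_2,C_3,F_2,F_3,W,Y,Z$ such that: * $A_0,A_1,B_0,B_1,B_2,B_3,C_1,C_2,C_3$ are nonempty cliques; * $F_2,F_3,Y$ are cliques, at most one of which is nonempty, and $W$ is a clique; * $A_0$ is complete to $A_1$; * $A_0$ is complete to $B_0,B_2,B_3$ and anticomplete to $B_1,C_1,C_2,C_3$; * $A_1$ is complete to $B_1,B_2,B_3$ and anticomplete to $B_0,C_1,C_2,C_3$; * $B_0,B_1,B_2,B_3$ are pairwise anticomplete, and $C_1,C_2,C_3$ are pairwise complete; * $C_1$ is complete to $B_0,B_1$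 and anticomplete to $B_2,B_3$; * $C_2$ is complete to $B_2$ and anticomplete to $B_0,B_1,B_3$; * $C_3$ is complete to $B_3$ and anticomplete to $B_0,B_1,B_2$; * $F_2$ is complete to $A_0,A_1,B_0,B_1,B_3,C_1,C_3$ and anticomplete to $B_2,C_2$; * $F_3$ is complete to $A_0,A_1,B_0,B_1,B_2,C_1,C_2$ and anticomplete to $B_3,C_3$; * $W$ is complete to $A_0,A_1,B_0,B_1,B_2,B_3,C_1,C_2,C_3,F_2,F_3$; * $Y$ is complete to $C_2,C_3$ and anticomplete to $A_0,A_1,B_0,B_1,B_2,B_3,C_1$; * $Z$ is anticomplete to $A_0,A_1,B_0,B_1,B_2,B_3,C_1,C_2,C_3,Y$; * $Y$ is nested; * $Z$ is empty or can be partitioned into nonempty, pairwise anticomplete, nested cliques. -/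

import Mathlib

namespace SimpleGraph

universe u

variable {V : Type u}

/-- The disjoint union of two copies of the path on three vertices. -/
abbrev twoP3 : SimpleGraph (Fin 3 ⊕ Fin 3) := pathGraph 3 ⊕g pathGraph 3

/-- The graph `T₀` on nine vertices. In order, the vertices `0, …, 8` are
`a₀, a₁, b₀, b₁, b₂, b₃, c₁, c₂, c₃`. -/
def graphT0 : SimpleGraph (Fin 9) :=
  fromEdgeSet
    {s(0, 1),
     s(0, 2), s(0, 4), s(0, 5),
     s(1, 3), s(1, 4), s(1, 5),
     s(6, 7), s(6, 8), s(7, 8),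
     s(6, 2), s(6, 3), s(7, 4), s(8, 5)}

/-- `S` is anticomplete to `T` in `G`: no vertex of `S` is adjacent to a vertex of `T`. -/
def IsAnticompleteBetween (G : SimpleGraph V) (S T : Set V) : Prop :=
  ∀ ⦃v⦄, v ∈ S → ∀ ⦃w⦄, w ∈ T → ¬ G.Adj v w

/-- The closed neighborhood `N_G[v]`. -/
def closedNbhd (G : SimpleGraph V) (v : V) : Set V := insert v (G.neighborSet v)

/-- The set `S` can be ordered as `S = {s₁, …, sᵣ}` (possibly `r = 0`) so that
`N_G[sᵣ] ⊆ … ⊆ N_G[s₁]`. -/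
def HasNestedOrdering (G : SimpleGraph V) (S : Set V) : Prop :=
  ∃ (r : ℕ) (s : Fin r → V), Function.Injective s ∧ Set.range s = S ∧
    ∀ i j : Fin r, i ≤ j → G.closedNbhd (s j) ⊆ G.closedNbhd (s i)

/-- `S` can be partitioned into nonempty cliques `S₁, …, Sₗ`, pairwise anticomplete to each other,
each of which has a nested ordering. The case `ℓ = 0` is exactly the case `S = ∅`. -/
def HasNestedCliquePartition (G : SimpleGraph V) (S : Set V) : Prop :=
  ∃ (l : ℕ) (P : Fin l → Set V),
    Pairwise (fun i j => Disjoint (P i) (P j)) ∧ (⋃ i, P i) = S ∧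
    (∀ i, (P i).Nonempty) ∧ (∀ i, G.IsClique (P i)) ∧
    Pairwise (fun i j => G.IsAnticompleteBetween (P i) (P j)) ∧
    ∀ i, G.HasNestedOrdering (P i)

/-- Names of the 22 parts of a special partition. -/
inductive SpecialPart : Type
  | X (i : ZMod 7)
  | Y (i : ZMod 7)
  | Z (i : ZMod 7)
  | W

open SpecialPart in
/-- `P` is a special partition of the subgraph of `G` induced by `S`. Parts may be empty unless
stated otherwise. -/
structure IsSpecialPartition (G : SimpleGraph V) (S : Set V) (P : SpecialPart → Set V) :
    Prop where
  disjoint : Pairwise fun p q => Disjoint (P p) (P q)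
  union : (⋃ p, P p) = S
  clique : ∀ p, G.IsClique (P p)
  X_nonempty : ∀ i, (P (X i)).Nonempty
  X_complete_X : ∀ i, ∀ k ∈ ({-1, 1} : Set (ZMod 7)),
    G.IsCompleteBetween (P (X i)) (P (X (i + k)))
  X_anticomplete_X : ∀ i, ∀ k ∈ ({2, 3, 4, 5} : Set (ZMod 7)),
    G.IsAnticompleteBetween (P (X i)) (P (X (i + k)))
  X_complete_Y : ∀ i, ∀ k ∈ ({0, 3, 6} : Set (ZMod 7)),
    G.IsCompleteBetween (P (X i)) (P (Y (i + k)))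
  X_complete_Z : ∀ i, ∀ k ∈ ({0, 3, 4, 5, 6} : Set (ZMod 7)),
    G.IsCompleteBetween (P (X i)) (P (Z (i + k)))
  X_complete_W : ∀ i, G.IsCompleteBetween (P (X i)) (P W)
  X_anticomplete_Y : ∀ i, ∀ k ∈ ({1, 2, 4, 5} : Set (ZMod 7)),
    G.IsAnticompleteBetween (P (X i)) (P (Y (i + k)))
  X_anticomplete_Z : ∀ i, ∀ k ∈ ({1, 2} : Set (ZMod 7)),
    G.IsAnticompleteBetween (P (X i)) (P (Z (i + k)))
  Y_empty : ∀ i, (P (Y i)).Nonempty →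
    (∀ k ∈ ({1, 2, 5, 6} : Set (ZMod 7)), P (Y (i + k)) = ∅) ∧
    (∀ k ∈ ({5, 6} : Set (ZMod 7)), P (Z (i + k)) = ∅) ∧
    (P (Y (i + 3)) = ∅ ∨ P (Y (i + 4)) = ∅)
  Z_empty : ∀ i, (P (Z i)).Nonempty → P (Z (i + 2)) = ∅ ∧ P (Z (i + 5)) = ∅
  Y_complete_Y : ∀ i, ∀ k ∈ ({3, 4} : Set (ZMod 7)),
    G.IsCompleteBetween (P (Y i)) (P (Y (i + k)))
  Y_complete_Z : ∀ i, ∀ k ∈ ({0, 1, 3, 4} : Set (ZMod 7)),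
    G.IsCompleteBetween (P (Y i)) (P (Z (i + k)))
  Y_complete_W : ∀ i, G.IsCompleteBetween (P (Y i)) (P W)
  Y_anticomplete_Z : ∀ i, G.IsAnticompleteBetween (P (Y i)) (P (Z (i + 2)))
  Z_complete_Z : ∀ i, ∀ k ∈ ({1, 3, 4, 6} : Set (ZMod 7)),
    G.IsCompleteBetween (P (Z i)) (P (Z (i + k)))
  Z_complete_W : ∀ i, G.IsCompleteBetween (P (Z i)) (P W)

open SpecialPart in
/-- The set `A` and the parts `P` (a partition of the complement of `A`) form a 7-saucer partition
of `G`. -/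
structure IsSevenSaucerPartition (G : SimpleGraph V) (P : SpecialPart → Set V) (A : Set V) :
    Prop where
  special : G.IsSpecialPartition Aᶜ P
  A_anticomplete_X : ∀ i, G.IsAnticompleteBetween A (P (X i))
  A_anticomplete_Y_or : ∀ i, G.IsAnticompleteBetween A (P (Y i)) ∨ P (Z (i + 2)) = ∅
  A_nested : G.HasNestedCliquePartition A

/-- `G` is a 7-saucer. -/
def IsSevenSaucer (G : SimpleGraph V) : Prop :=
  ∃ (P : SpecialPart → Set V) (A : Set V), G.IsSevenSaucerPartition P A

/-- Names of the 14 parts of a tent partition. -/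
inductive TentPart : Type
  | A0 | A1 | B0 | B1 | B2 | B3 | C1 | C2 | C3 | F2 | F3 | W | Y | Z

open TentPart in
/-- `P` is a tent partition of `G`. Parts may be empty unless stated otherwise. -/
structure IsTentPartition (G : SimpleGraph V) (P : TentPart → Set V) : Prop where
  disjoint : Pairwise fun p q => Disjoint (P p) (P q)
  union : (⋃ p, P p) = Set.univ
  ABC_nonempty : ∀ p ∈ ({A0, A1, B0, B1, B2, B3, C1, C2, C3} : Set TentPart), (P p).Nonempty
  clique : ∀ p ∈ ({A0, A1, B0, B1, B2, B3, C1, C2, C3, F2, F3, W, Y} : Set TentPart),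
    G.IsClique (P p)
  FY_empty : ({F2, F3, Y} : Set TentPart).Pairwise fun p q => P p = ∅ ∨ P q = ∅
  A0_complete_A1 : G.IsCompleteBetween (P A0) (P A1)
  A0_complete : ∀ p ∈ ({B0, B2, B3} : Set TentPart), G.IsCompleteBetween (P A0) (P p)
  A0_anticomplete : ∀ p ∈ ({B1, C1, C2, C3} : Set TentPart),
    G.IsAnticompleteBetween (P A0) (P p)
  A1_complete : ∀ p ∈ ({B1, B2, B3} : Set TentPart), G.IsCompleteBetween (P A1) (P p)
  A1_anticomplete : ∀ p ∈ ({B0, C1, C2, C3} : Set TentPart),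
    G.IsAnticompleteBetween (P A1) (P p)
  B_anticomplete : ({B0, B1, B2, B3} : Set TentPart).Pairwise fun p q =>
    G.IsAnticompleteBetween (P p) (P q)
  C_complete : ({C1, C2, C3} : Set TentPart).Pairwise fun p q =>
    G.IsCompleteBetween (P p) (P q)
  C1_complete : ∀ p ∈ ({B0, B1} : Set TentPart), G.IsCompleteBetween (P C1) (P p)
  C1_anticomplete : ∀ p ∈ ({B2, B3} : Set TentPart), G.IsAnticompleteBetween (P C1) (P p)
  C2_complete : G.IsCompleteBetween (P C2) (P B2)
  C2_anticomplete : ∀ p ∈ ({B0, B1, B3} : Set TentPart), G.IsAnticompleteBetween (P C2) (P p)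
  C3_complete : G.IsCompleteBetween (P C3) (P B3)
  C3_anticomplete : ∀ p ∈ ({B0, B1, B2} : Set TentPart), G.IsAnticompleteBetween (P C3) (P p)
  F2_complete : ∀ p ∈ ({A0, A1, B0, B1, B3, C1, C3} : Set TentPart),
    G.IsCompleteBetween (P F2) (P p)
  F2_anticomplete : ∀ p ∈ ({B2, C2} : Set TentPart), G.IsAnticompleteBetween (P F2) (P p)
  F3_complete : ∀ p ∈ ({A0, A1, B0, B1, B2, C1, C2} : Set TentPart),
    G.IsCompleteBetween (P F3) (P p)
  F3_anticomplete : ∀ p ∈ ({B3, C3} : Set TentPart), G.IsAnticompleteBetween (P F3) (P p)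
  W_complete : ∀ p ∈ ({A0, A1, B0, B1, B2, B3, C1, C2, C3, F2, F3} : Set TentPart),
    G.IsCompleteBetween (P W) (P p)
  Y_complete : ∀ p ∈ ({C2, C3} : Set TentPart), G.IsCompleteBetween (P Y) (P p)
  Y_anticomplete : ∀ p ∈ ({A0, A1, B0, B1, B2, B3, C1} : Set TentPart),
    G.IsAnticompleteBetween (P Y) (P p)
  Z_anticomplete : ∀ p ∈ ({A0, A1, B0, B1, B2, B3, C1, C2, C3, Y} : Set TentPart),
    G.IsAnticompleteBetween (P Z) (P p)
  Y_nested : G.HasNestedOrdering (P Y)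
  Z_nested : G.HasNestedCliquePartition (P Z)

/-- `G` is a tent. -/
def IsTent (G : SimpleGraph V) : Prop :=
  ∃ P : TentPart → Set V, G.IsTentPartition P

end SimpleGraph

open scoped SimpleGraph

namespace SimpleGraph

variable {V : Type*}

/-! Fix an induced $C_7$ or, if there is none, an induced $T_0$, and sort all vertices by their
trace, the closed neighborhood on this base. A trace that does not belong to one of the 23 parts of
a saucer (or 14 parts of a tent) produces a forbidden graph together with the base. So does a wrong
adjacency between two vertices of known traces. Where both adjacencies are wrong, the two parts
cannot both be nonempty. Each of these claims involves at most 12 vertices and is settled by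
computation: `saucer_one`, `saucer_two`, `tent_one`, `tent_two` and a few checks with three
additional vertices.

What remains is the structure of the part with empty trace ($A$, or $Z$ in a tent) and of $Y$ in a
tent. An induced three-vertex path inside $A$ would form a $2P_3$ with a path of the base, so $A$ is
a disjoint union of cliques. The neighbors of $A$ outside $A$ form a clique. If two adjacent
vertices of $A$ had private neighbors $w,w'$, these would close an induced $C_4$; hence each clique
is nested. The same arguments work for $Z$ and, for nestedness, for $Y$.

Conversely, an induced copy of a forbidden graph inherits labels from the parts, and a finite search
shows that no such labeling obeys the rules. The search needs the copy to stay away from the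
unbounded freedom in the nested parts. Adjacent vertices of $C_4$ or $C_6$ have incomparable closed
neighborhoods, whereas adjacent vertices of a nested clique have comparable ones. It follows that in
a saucer the copy avoids $A$ entirely (`IsSaucerLabeling.labelable_cycle`,
`IsSaucerLabeling.ne_of_paths`). In a tent no edge of a cycle lies inside $Y$ or $Z$, and each path
of a $2P_3$ has a vertex outside $Z$. -/

/-- Equality or adjacency: `G.AdjOrEq u v` says that `v` lies in the closed neighborhood of `u`. -/
def AdjOrEq (G : SimpleGraph V) (u v : V) : Prop := u = v ∨ G.Adj u v

/-! The functions that are evaluated by the kernel are given by recursors, which unfold faster than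
structural recursion. -/

/-- The bit of `m` in position `i`. -/
noncomputable def bitOf (m i : ℕ) : Bool := Nat.beq (Nat.land (Nat.shiftRight m i) 1) 1

theorem bitOf_eq_testBit (m i : ℕ) : bitOf m i = m.testBit i := by
  have h : Nat.land (Nat.shiftRight m i) 1 = (m >>> i) % 2 := Nat.and_one_is_mod _
  rw [bitOf, h, Nat.testBit_eq_decide_div_mod_eq, Nat.shiftRight_eq_div_pow, Bool.eq_iff_iff,
    Nat.beq_eq, decide_eq_true_iff]

/-- The entry of the list `l` in position `i`, or `0` if there is none. -/
noncomputable def entry (l : List ℕ) : ℕ → ℕ :=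
  List.rec (fun _ => 0) (fun a _ ih i => Nat.rec a (fun j _ => ih j) i) l

theorem entry_eq_getD (l : List ℕ) (i : ℕ) : entry l i = l.getD i 0 := by
  induction l generalizing i with
  | nil => rfl
  | cons a l ih =>
    cases i with
    | zero => rfl
    | succ i => exact ih i

/-- The entry in row `i` and column `j` of a Boolean matrix whose rows are given as bit masks. -/
noncomputable def bitAt (M : List ℕ) (i j : ℕ) : Bool := bitOf (entry M i) j

/-- Whether some number below `N` satisfies `p`. -/
noncomputable def anyBelow (N : ℕ) (p : ℕ → Bool) : Bool :=
  Nat.rec false (fun n ih => Bool.rec ih true (p n)) N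

theorem anyBelow_eq_true {N : ℕ} {p : ℕ → Bool} :
    anyBelow N p = true ↔ ∃ n < N, p n = true := by
  induction N with
  | zero => simp [anyBelow]
  | succ N ih =>
    have h : anyBelow (N + 1) p = Bool.rec (anyBelow N p) true (p N) := rfl
    rw [h]
    cases hp : p N
    · change anyBelow N p = true ↔ _
      rw [ih]
      refine ⟨fun ⟨n, h1, h2⟩ => ⟨n, by omega, h2⟩, fun ⟨n, h1, h2⟩ => ⟨n, ?_, h2⟩⟩
      rcases Nat.lt_succ_iff_lt_or_eq.1 h1 with h | rfl
      · exact h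
      · simp [hp] at h2
    · exact ⟨fun _ => ⟨N, by omega, hp⟩, fun _ => rfl⟩

/-! ### Closed adjacency matrices and induced copies. -/

/-- The relation `r` restricted to `f 0, …, f (n - 1)` is given by the Boolean matrix `A`. -/
def Realizes (r : V → V → Prop) (f : ℕ → V) (n : ℕ) (A : ℕ → ℕ → Bool) : Prop :=
  ∀ i < n, ∀ j < n, (r (f i) (f j) ↔ A i j = true)

/-- The first `n` vertices of the matrix `M` occur as an induced subgraph of `G`. Only the part
above the diagonal of `M` is taken into account. -/
def Occurs (G : SimpleGraph V) (n : ℕ) (M : List ℕ) : Prop :=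
  ∃ f : ℕ → V, ∀ i < n, ∀ j < i, (G.AdjOrEq (f j) (f i) ↔ bitAt M j i = true)

theorem AdjOrEq.refl (G : SimpleGraph V) (u : V) : G.AdjOrEq u u := Or.inl rfl

theorem AdjOrEq.symm {G : SimpleGraph V} {u v : V} (h : G.AdjOrEq u v) : G.AdjOrEq v u :=
  h.imp Eq.symm Adj.symm

theorem adjOrEq_comm {G : SimpleGraph V} {u v : V} : G.AdjOrEq u v ↔ G.AdjOrEq v u :=
  ⟨AdjOrEq.symm, AdjOrEq.symm⟩

theorem AdjOrEq.adj {G : SimpleGraph V} {u v : V} (h : G.AdjOrEq u v) (hne : u ≠ v) :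
    G.Adj u v := h.resolve_left hne

theorem mem_closedNbhd {G : SimpleGraph V} {u v : V} : v ∈ G.closedNbhd u ↔ G.AdjOrEq u v := by
  simp [closedNbhd, AdjOrEq, eq_comm]

theorem isClique_iff_adjOrEq {G : SimpleGraph V} {S : Set V} :
    G.IsClique S ↔ ∀ u ∈ S, ∀ v ∈ S, G.AdjOrEq u v := by
  refine ⟨fun h u hu v hv => ?_, fun h u hu v hv hne => (h u hu v hv).adj hne⟩
  by_cases huv : u = v
  · exact Or.inl huv
  · exact Or.inr (h hu hv huv)

/-- Closed adjacency makes injectivity automatic: two pattern vertices with the same image would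
have equal rows, which `hH` excludes. -/
theorem occurs_iff_isIndContained {n : ℕ} {H : SimpleGraph (Fin (n + 1))} {M : List ℕ}
    (hM : ∀ i j : Fin (n + 1), bitAt M i j = true ↔ i = j ∨ H.Adj i j)
    (hH : ∀ i j : Fin (n + 1), (∀ k : Fin (n + 1), bitAt M i k = bitAt M j k) → i = j)
    (G : SimpleGraph V) : G.Occurs (n + 1) M ↔ H ⊴ G := by
  constructor
  · rintro ⟨f, hf⟩
    have key : ∀ i j : Fin (n + 1), G.AdjOrEq (f i) (f j) ↔ i = j ∨ H.Adj i j := by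
      intro i j
      rcases lt_trichotomy i j with h | h | h
      · rw [hf j j.2 i h, hM]
      · simp [h, AdjOrEq.refl]
      · rw [adjOrEq_comm, hf i i.2 j h, hM, adj_comm, eq_comm]
    have inj : Function.Injective fun i : Fin (n + 1) => f i := by
      intro i j hij
      refine hH i j fun k => ?_
      have h1 := key i k
      have h2 := key j k
      simp only at hij
      rw [hij, h2, ← hM, ← hM] at h1
      exact (Bool.eq_iff_iff.2 h1).symm
    refine ⟨⟨⟨fun i => f i, inj⟩, ?_⟩⟩
    intro i j
    have := key i j
    simp only [Function.Embedding.coeFn_mk]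
    by_cases hij : i = j
    · simp [hij]
    · have hij' : f i ≠ f j := fun h => hij (inj h)
      simpa [AdjOrEq, hij, hij'] using this
  · rintro ⟨e⟩
    refine ⟨fun i => e (Fin.ofNat (n + 1) i), fun i hi j hj => ?_⟩
    have hj' : j < n + 1 := hj.trans hi
    have h1 : ((Fin.ofNat (n + 1) i : Fin (n + 1)) : ℕ) = i := Nat.mod_eq_of_lt hi
    have h2 : ((Fin.ofNat (n + 1) j : Fin (n + 1)) : ℕ) = j := Nat.mod_eq_of_lt hj'
    have := hM (Fin.ofNat (n + 1) j) (Fin.ofNat (n + 1) i)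
    rw [h1, h2] at this
    rw [this]
    simp [AdjOrEq, e.injective.eq_iff]

theorem Occurs.realizes {G : SimpleGraph V} {n : ℕ} {M : List ℕ}
    (hM : ∀ i < n, ∀ j < n, bitAt M i j = bitAt M j i) (hM' : ∀ i < n, bitAt M i i = true)
    (h : G.Occurs n M) : ∃ f : ℕ → V, Realizes G.AdjOrEq f n (bitAt M) := by
  obtain ⟨f, hf⟩ := h
  refine ⟨f, fun i hi j hj => ?_⟩
  rcases lt_trichotomy i j with h | rfl | h
  · exact hf j hj i h
  · simp [AdjOrEq.refl, hM' i hi]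
  · rw [adjOrEq_comm, hf i hi j h, hM j hj i hi]

/-! ### Assigning labels to the vertices of a pattern -/

/-- The bit mask of the numbers below `N` that satisfy `p`. -/
noncomputable def maskOf (p : ℕ → Bool) (N : ℕ) : ℕ :=
  Nat.rec 0 (fun n ih => Bool.rec ih (Nat.lor ih (Nat.pow 2 n)) (p n)) N

theorem testBit_maskOf (p : ℕ → Bool) (N i : ℕ) :
    (maskOf p N).testBit i = (decide (i < N) && p i) := by
  induction N with
  | zero => simp [maskOf]
  | succ N ih =>
    have h : maskOf p (N + 1) = Bool.rec (maskOf p N) (maskOf p N ||| 2 ^ N) (p N) := rfl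
    rw [h]
    cases hp : p N
    · change (maskOf p N).testBit i = _
      rw [ih]
      by_cases hi : i = N
      · simp [hi, hp]
      · simp [show i < N + 1 ↔ i < N by omega]
    · change (maskOf p N ||| 2 ^ N).testBit i = _
      rw [Nat.testBit_lor, ih, Nat.testBit_two_pow]
      by_cases hi : i = N
      · simp [hi, hp]
      · simp [show i < N + 1 ↔ i < N by omega, Ne.symm hi]

/-- The candidates for the vertices `j, j + 1, …` of a pattern that are left after the label `v` has
been given to a vertex whose row in the pattern is `row`. -/
def narrow (R : Bool → ℕ → ℕ) (row v : ℕ) : ℕ → List ℕ → List ℕ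
  | _, [] => []
  | j, c :: cs => (c &&& R (row.testBit j) v) :: narrow R row v (j + 1) cs

/-- The value of `k` at `narrow R row v j cs` if there remains a candidate for every vertex, and
`false` otherwise. -/
noncomputable def narrowThen (R : Bool → ℕ → ℕ) (row v : ℕ) (cs : List ℕ) :
    ℕ → (List ℕ → Bool) → Bool :=
  List.rec (fun _ k => k [])
    -- Case distinction on the narrowed mask: zero means that some vertex has lost all its
    -- candidates, and the continuation `k` is not called.
    (fun c _ ih j k => Nat.rec false (fun d _ => ih (Nat.succ j) fun ds => k (Nat.succ d :: ds))
      (Bool.rec (Nat.land c (R false v)) (Nat.land c (R true v)) (bitOf row j))) cs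

theorem narrowThen_eq (R : Bool → ℕ → ℕ) (row v : ℕ) (cs : List ℕ) (j : ℕ) (k : List ℕ → Bool) :
    narrowThen R row v cs j k =
      ((narrow R row v j cs).all (fun d => d != 0) && k (narrow R row v j cs)) := by
  induction cs generalizing j k with
  | nil => rfl
  | cons c cs ih =>
    have h : narrowThen R row v (c :: cs) j k =
        Nat.rec false (fun d _ => narrowThen R row v cs (j + 1) fun ds => k (Nat.succ d :: ds))
          (Bool.rec (c &&& R false v) (c &&& R true v) (bitOf row j)) := rfl
    have h2 : (Bool.rec (c &&& R false v) (c &&& R true v) (bitOf row j) : ℕ) =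
        c &&& R (row.testBit j) v := by
      rw [bitOf_eq_testBit]
      cases row.testBit j <;> rfl
    rw [h, h2, narrow]
    cases c &&& R (row.testBit j) v with
    | zero => simp
    | succ d =>
      change narrowThen R row v cs (j + 1) (fun ds => k (Nat.succ d :: ds)) = _
      rw [ih]
      simp

/-- Whether the vertices `k, …, k + m - 1` of the pattern `M` can be labelled from their lists `cs`
of candidates in such a way that the labels `v` and `w` of two vertices satisfy `w ∈ R b v`, where
`b` is the entry of the pattern at these vertices. -/
noncomputable def labelable (R : Bool → ℕ → ℕ) (N : ℕ) (M : List ℕ) (m : ℕ) :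
    ℕ → List ℕ → Bool :=
  Nat.rec (fun _ _ => true)
    (fun _ ih k cs => List.rec true (fun c cs _ => anyBelow N fun v =>
      Bool.rec false (narrowThen R (entry M k) v cs (Nat.succ k) (ih (Nat.succ k))) (bitOf c v)) cs)
    m

theorem labelable_cons {R : Bool → ℕ → ℕ} {N : ℕ} {M : List ℕ} {m k c : ℕ} {cs : List ℕ} :
    labelable R N M (m + 1) k (c :: cs) = true ↔ ∃ v < N, c.testBit v = true ∧
      (∀ d ∈ narrow R (entry M k) v (k + 1) cs, d ≠ 0) ∧
      labelable R N M m (k + 1) (narrow R (entry M k) v (k + 1) cs) = true := by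
  have h : labelable R N M (m + 1) k (c :: cs) = anyBelow N fun v =>
      Bool.rec false (narrowThen R (entry M k) v cs (k + 1) (labelable R N M m (k + 1)))
        (bitOf c v) := rfl
  rw [h, anyBelow_eq_true]
  refine exists_congr fun v => and_congr_right fun _ => ?_
  rw [bitOf_eq_testBit]
  cases c.testBit v
  · simp
  · change narrowThen R (entry M k) v cs (k + 1) (labelable R N M m (k + 1)) = true ↔ _
    rw [narrowThen_eq]
    simp

theorem length_narrow (R : Bool → ℕ → ℕ) (row v j : ℕ) (cs : List ℕ) :
    (narrow R row v j cs).length = cs.length := by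
  induction cs generalizing j with
  | nil => rfl
  | cons c cs ih => simp [narrow, ih]

theorem testBit_getD_narrow (R : Bool → ℕ → ℕ) (M : List ℕ) (k v j : ℕ) (cs : List ℕ) (i w : ℕ) :
    ((narrow R (entry M k) v j cs).getD i 0).testBit w =
      ((cs.getD i 0).testBit w && (R (bitAt M k (j + i)) v).testBit w) := by
  induction cs generalizing i j with
  | nil => simp [narrow]
  | cons c cs ih =>
    cases i with
    | zero => simp [narrow, bitAt, bitOf_eq_testBit]
    | succ i => simpa [narrow, Nat.add_right_comm, Nat.add_assoc] using ih (j + 1) i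

/-- Soundness of the search: this direction turns a successful `hasPattern` into an actual induced
copy. -/
theorem exists_of_labelable {R : Bool → ℕ → ℕ} {N : ℕ} {M : List ℕ} (m k : ℕ) (cs : List ℕ)
    (hcs : cs.length = m) (h : labelable R N M m k cs = true) :
    ∃ g : ℕ → ℕ, ∀ i < m, (cs.getD i 0).testBit (g i) = true ∧ g i < N ∧
      ∀ j < i, (R (bitAt M (k + j) (k + i)) (g j)).testBit (g i) = true := by
  induction m generalizing k cs with
  | zero => exact ⟨fun _ => 0, by simp⟩
  | succ m ih =>
    obtain ⟨c, cs, rfl⟩ := List.exists_cons_of_length_eq_add_one hcs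
    obtain ⟨v, hv, hc, -, hrec⟩ := labelable_cons.1 h
    obtain ⟨g, hg⟩ := ih (k + 1) _ (by simpa [length_narrow] using hcs) hrec
    refine ⟨fun i => i.casesOn v g, fun i hi => ?_⟩
    cases i with
    | zero => exact ⟨hc, hv, by simp⟩
    | succ i =>
      obtain ⟨h1, h2, h3⟩ := hg i (by omega)
      rw [testBit_getD_narrow, Bool.and_eq_true] at h1
      refine ⟨by simpa using h1.1, h2, fun j hj => ?_⟩
      cases j with
      | zero => simpa [Nat.add_right_comm, Nat.add_assoc] using h1.2
      | succ j => simpa [Nat.add_right_comm, Nat.add_assoc] using h3 j (by omega)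

/-- Completeness of the search: the labels `g` survive every narrowing, so the pruning loses
nothing. A failed search therefore refutes every labeling. -/
theorem labelable_of_forall {R : Bool → ℕ → ℕ} {N : ℕ} {M : List ℕ} (m k : ℕ) (cs : List ℕ)
    (hcs : cs.length = m) (g : ℕ → ℕ)
    (hg : ∀ i < m, (cs.getD i 0).testBit (g i) = true ∧ g i < N ∧
      ∀ j < i, (R (bitAt M (k + j) (k + i)) (g j)).testBit (g i) = true) :
    labelable R N M m k cs = true := by
  induction m generalizing k cs g with
  | zero => rfl
  | succ m ih =>
    obtain ⟨c, cs, rfl⟩ := List.exists_cons_of_length_eq_add_one hcs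
    obtain ⟨h1, h2, -⟩ := hg 0 (by omega)
    have hlen : cs.length = m := by simpa using hcs
    have key : ∀ i < m,
        ((narrow R (entry M k) (g 0) (k + 1) cs).getD i 0).testBit (g (i + 1)) = true := by
      intro i hi
      obtain ⟨h3, -, h4⟩ := hg (i + 1) (by omega)
      rw [testBit_getD_narrow, Bool.and_eq_true]
      refine ⟨by simpa using h3, ?_⟩
      simpa [Nat.add_right_comm, Nat.add_assoc] using h4 0 (by omega)
    refine labelable_cons.2 ⟨g 0, h2, by simpa using h1, ?_, ?_⟩
    · intro d hd h0
      obtain ⟨i, hi, rfl⟩ := List.getElem_of_mem hd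
      have := key i (by simpa [length_narrow, hlen] using hi)
      rw [List.getD_eq_getElem _ _ hi, h0, Nat.zero_testBit] at this
      exact Bool.false_ne_true this
    · refine ih (k + 1) _ (by rw [length_narrow, hlen]) (fun i => g (i + 1)) fun i hi => ?_
      obtain ⟨-, h4, h5⟩ := hg (i + 1) (by omega)
      refine ⟨key i hi, h4, fun j hj => ?_⟩
      simpa [Nat.add_right_comm, Nat.add_assoc] using h5 (j + 1) (by omega)

/-- The labels below `N` that are related by `r` to the label `v`. -/
noncomputable def relRow (r : ℕ → ℕ → Bool → Bool) (N : ℕ) (b : Bool) (v : ℕ) : ℕ :=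
  maskOf (fun w => r v w b) N

/-- One of the patterns in the list `L` (given with their numbers of vertices) is found in the
host graph `A` on `N` vertices. -/
noncomputable def hasPattern (L : List (ℕ × List ℕ)) (A : ℕ → ℕ → Bool) (N : ℕ) : Bool :=
  L.any fun p => labelable (relRow (fun v w b => Bool.rec (Bool.not b) b (A v w)) N) N p.2 p.1 0
    (List.replicate p.1 (2 ^ N - 1))

/-- No pattern of the list `L` (given with their numbers of vertices) occurs in `G`. -/
def AvoidsPatterns (G : SimpleGraph V) (L : List (ℕ × List ℕ)) : Prop :=
  ∀ p ∈ L, ¬ G.Occurs p.1 p.2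

theorem AvoidsPatterns.hasPattern_eq_false {G : SimpleGraph V} {L : List (ℕ × List ℕ)}
    (hG : G.AvoidsPatterns L) {f : ℕ → V} {N : ℕ} {A : ℕ → ℕ → Bool}
    (hf : Realizes G.AdjOrEq f N A) : hasPattern L A N = false := by
  rw [← Bool.not_eq_true]
  intro h
  simp only [hasPattern, List.any_eq_true] at h
  obtain ⟨p, hp, h⟩ := h
  obtain ⟨g, hg⟩ := exists_of_labelable _ _ _ (by simp) h
  refine hG p hp ⟨fun i => f (g i), fun i hi j hj => ?_⟩
  obtain ⟨-, h1, h2⟩ := hg i hi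
  have h3 := (hg j (hj.trans hi)).2.1
  have h4 := h2 j hj
  simp only [relRow, testBit_maskOf, Bool.and_eq_true, zero_add] at h4
  rw [hf _ h3 _ h1]
  have h5 := h4.2
  cases h6 : A (g j) (g i) <;> cases h7 : bitAt p.2 j i <;> simp [h6, h7] at h5 ⊢

/-! ### Host graphs: a fixed base together with a few further vertices -/

/-- The host graph that consists of a base on `n` vertices with matrix `B` and of further vertices
with traces `ms` on the base and with matrix `E`. -/
noncomputable def hostBit (n : ℕ) (B ms E : List ℕ) (i j : ℕ) : Bool :=
  Bool.rec
    (Bool.rec (bitAt B i j) (bitOf (entry ms (Nat.sub j n)) i) (Nat.ble n j))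
    (Bool.rec (bitOf (entry ms (Nat.sub i n)) j) (bitAt E (Nat.sub i n) (Nat.sub j n))
      (Nat.ble n j)) (Nat.ble n i)

open Classical in
/-- The closed neighborhood of `v` on `x 0, …, x (n - 1)`, as a bit mask. -/
noncomputable def trace (G : SimpleGraph V) (x : ℕ → V) (n : ℕ) (v : V) : ℕ :=
  Nat.ofBits fun i : Fin n => decide (G.AdjOrEq v (x i))

theorem trace_lt (G : SimpleGraph V) (x : ℕ → V) (n : ℕ) (v : V) : G.trace x n v < 2 ^ n :=
  Nat.ofBits_lt_two_pow _

theorem testBit_trace (G : SimpleGraph V) (x : ℕ → V) {n i : ℕ} (hi : i < n) (v : V) :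
    (G.trace x n v).testBit i = true ↔ G.AdjOrEq v (x i) := by
  simp [trace, Nat.testBit_ofBits_lt _ _ hi]

/-- This places each base vertex in the part of its own number, so that these parts are nonempty. -/
theorem trace_base {G : SimpleGraph V} {x : ℕ → V} {n : ℕ} {B : List ℕ}
    (hx : Realizes G.AdjOrEq x n (bitAt B)) {i : ℕ} (hi : i < n) (hB : B.getD i 0 < 2 ^ n) :
    G.trace x n (x i) = B.getD i 0 := by
  refine Nat.eq_of_testBit_eq fun j => ?_
  by_cases hj : j < n
  · rw [Bool.eq_iff_iff, testBit_trace G x hj, hx i hi j hj, bitAt, bitOf_eq_testBit,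
      entry_eq_getD]
  · have h2 : 2 ^ n ≤ 2 ^ j := Nat.pow_le_pow_right (by norm_num) (not_lt.1 hj)
    rw [Nat.testBit_lt_two_pow ((trace_lt G x n _).trans_le h2),
      Nat.testBit_lt_two_pow (hB.trans_le h2)]

/-- The further vertices need not be distinct from each other or from the base, since the matrices
record closed adjacency. -/
theorem realizes_hostBit {G : SimpleGraph V} {x : ℕ → V} {n : ℕ} {B : List ℕ}
    (hx : Realizes G.AdjOrEq x n (bitAt B)) {u : ℕ → V} {k : ℕ} {ms E : List ℕ}
    (hms : ∀ a < k, ms.getD a 0 = G.trace x n (u a))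
    (hE : Realizes G.AdjOrEq u k (bitAt E)) :
    Realizes G.AdjOrEq (fun i => if i < n then x i else u (i - n)) (n + k)
      (hostBit n B ms E) := by
  have ble : ∀ i, Nat.ble n i = decide (n ≤ i) := fun i => by
    rw [Bool.eq_iff_iff, Nat.ble_eq, decide_eq_true_iff]
  intro i hi j hj
  by_cases h1 : i < n <;> by_cases h2 : j < n <;>
    simp only [hostBit, bitOf_eq_testBit, entry_eq_getD, ble, h1, h2, if_true, if_false,
      ← not_lt, not_true, not_false_iff, decide_true, decide_false]
  · exact hx i h1 j h2
  · change _ ↔ (ms.getD (j - n) 0).testBit i = true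
    rw [hms _ (by omega), testBit_trace _ _ h1, adjOrEq_comm]
  · change _ ↔ (ms.getD (i - n) 0).testBit j = true
    rw [hms _ (by omega), testBit_trace _ _ h2]
  · exact hE _ (by omega) _ (by omega)

section Extensions

variable {G : SimpleGraph V} {L : List (ℕ × List ℕ)} {x : ℕ → V} {n : ℕ} {B : List ℕ}

theorem AvoidsPatterns.extend_one (hG : G.AvoidsPatterns L)
    (hx : Realizes G.AdjOrEq x n (bitAt B)) (u : V) :
    hasPattern L (hostBit n B [G.trace x n u] [1]) (n + 1) = false := by
  refine hG.hasPattern_eq_false (realizes_hostBit hx (u := fun _ => u) ?_ ?_)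
  · intro a ha
    obtain rfl : a = 0 := by omega
    rfl
  · intro i hi j hj
    obtain rfl : i = 0 := by omega
    obtain rfl : j = 0 := by omega
    exact iff_of_true (AdjOrEq.refl G u) (by decide)

/-- The matrix of two vertices, adjacent if and only if `b` holds. -/
def pairMatrix (b : Bool) : List ℕ := bif b then [3, 3] else [1, 2]

/-- The matrix of three vertices with the given adjacencies `01`, `02` and `12`. -/
def tripleMatrix (b c d : Bool) : List ℕ :=
  [1 + 2 * b.toNat + 4 * c.toNat, 2 + b.toNat + 4 * d.toNat, 4 + c.toNat + 2 * d.toNat]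

theorem AvoidsPatterns.extend_two (hG : G.AvoidsPatterns L)
    (hx : Realizes G.AdjOrEq x n (bitAt B)) {u v : V} {b : Bool} (hb : G.AdjOrEq u v ↔ b = true) :
    hasPattern L (hostBit n B [G.trace x n u, G.trace x n v] (pairMatrix b)) (n + 2) = false := by
  refine hG.hasPattern_eq_false
    (realizes_hostBit hx (u := fun i => if i = 0 then u else v) ?_ ?_)
  · intro a ha
    interval_cases a <;> rfl
  · have hb' := adjOrEq_comm.trans hb
    intro i hi j hj
    interval_cases i <;> interval_cases j <;> cases b <;>
      simp_all [bitAt, AdjOrEq.refl, pairMatrix] <;> decide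

theorem AvoidsPatterns.extend_three (hG : G.AvoidsPatterns L)
    (hx : Realizes G.AdjOrEq x n (bitAt B)) {u v w : V} {b c d : Bool}
    (hb : G.AdjOrEq u v ↔ b = true) (hc : G.AdjOrEq u w ↔ c = true)
    (hd : G.AdjOrEq v w ↔ d = true) :
    hasPattern L (hostBit n B [G.trace x n u, G.trace x n v, G.trace x n w]
      (tripleMatrix b c d)) (n + 3) = false := by
  refine hG.hasPattern_eq_false
    (realizes_hostBit hx (u := fun i => if i = 0 then u else if i = 1 then v else w) ?_ ?_)
  · intro a ha
    interval_cases a <;> rfl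
  · have hb' := adjOrEq_comm.trans hb
    have hc' := adjOrEq_comm.trans hc
    have hd' := adjOrEq_comm.trans hd
    intro i hi j hj
    interval_cases i <;> interval_cases j <;> cases b <;> cases c <;> cases d <;>
      simp_all [bitAt, AdjOrEq.refl, tripleMatrix] <;> decide

end Extensions

/-! ### The patterns -/

/-- Closed adjacency matrix of the four-cycle. -/
def cycleFour : List ℕ := [11, 7, 14, 13]

/-- Closed adjacency matrix of the six-cycle. -/
def cycleSix : List ℕ := [35, 7, 14, 28, 56, 49]

/-- Closed adjacency matrix of the seven-cycle. -/
def cycleSeven : List ℕ := [67, 7, 14, 28, 56, 112, 97]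

/-- Closed adjacency matrix of two disjoint paths on three vertices. -/
def twoPaths : List ℕ := [3, 7, 6, 24, 56, 48]

/-- Closed adjacency matrix of the graph `T₀`. -/
def tentZero : List ℕ := [55, 59, 69, 74, 147, 291, 460, 464, 480]

theorem occurs_cycleFour (G : SimpleGraph V) : G.Occurs 4 cycleFour ↔ cycleGraph 4 ⊴ G :=
  occurs_iff_isIndContained (by decide) (by decide) G

theorem occurs_cycleSix (G : SimpleGraph V) : G.Occurs 6 cycleSix ↔ cycleGraph 6 ⊴ G :=
  occurs_iff_isIndContained (by decide) (by decide) G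

theorem occurs_cycleSeven (G : SimpleGraph V) : G.Occurs 7 cycleSeven ↔ cycleGraph 7 ⊴ G :=
  occurs_iff_isIndContained (by decide) (by decide) G

theorem occurs_twoPaths (G : SimpleGraph V) : G.Occurs 6 twoPaths ↔ twoP3 ⊴ G := by
  let e₀ : Fin 3 ⊕ Fin 3 ≃ Fin (3 + 3) := finSumFinEquiv
  have e : twoP3.comap e₀.symm ≃g twoP3 := Iso.comap _ _
  have key : ∀ a b, bitAt twoPaths (e₀ a) (e₀ b) = true ↔ a = b ∨ twoP3.Adj a b := by
    rintro (a | a) (b | b) <;>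
      simp only [twoP3, SimpleGraph.sum, pathGraph_adj, e₀, finSumFinEquiv_apply_left,
        finSumFinEquiv_apply_right] <;> revert a b <;> decide
  have h : G.Occurs 6 twoPaths ↔ twoP3.comap e₀.symm ⊴ G :=
    occurs_iff_isIndContained (n := 5)
      (fun i j => by
        have := key (e₀.symm i) (e₀.symm j)
        simpa only [Equiv.apply_symm_apply, e₀.symm.injective.eq_iff, comap_adj] using this)
      (by decide) G
  exact h.trans ⟨fun ⟨f⟩ => ⟨f.comp e.symm.toEmbedding⟩, fun ⟨f⟩ => ⟨f.comp e.toEmbedding⟩⟩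

set_option synthInstance.maxSize 2000 in
set_option synthInstance.maxHeartbeats 400000 in
theorem occurs_tentZero (G : SimpleGraph V) : G.Occurs 9 tentZero ↔ graphT0 ⊴ G := by
  refine occurs_iff_isIndContained ?_ (by decide) G
  simp only [graphT0, fromEdgeSet_adj, Set.mem_insert_iff, Set.mem_singleton_iff, Sym2.eq_iff]
  decide

/-- The forbidden induced subgraphs, with their numbers of vertices. -/
def forbiddenPatterns : List (ℕ × List ℕ) := [(4, cycleFour), (6, twoPaths), (6, cycleSix)]

theorem avoidsPatterns_forbiddenPatterns (G : SimpleGraph V) :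
    G.AvoidsPatterns forbiddenPatterns ↔
      ¬ twoP3 ⊴ G ∧ ¬ cycleGraph 4 ⊴ G ∧ ¬ cycleGraph 6 ⊴ G := by
  simp only [AvoidsPatterns, forbiddenPatterns, List.forall_mem_cons, occurs_cycleFour,
    occurs_cycleSix, occurs_twoPaths]
  simp; tauto

/-- Coincidences among the four vertices need no separate treatment, because `Occurs` does not ask
for injectivity. -/
theorem AvoidsPatterns.four_cycle {G : SimpleGraph V} {L : List (ℕ × List ℕ)}
    (hG : G.AvoidsPatterns L) (hL : (4, cycleFour) ∈ L) {a b c d : V} (hab : G.AdjOrEq a b)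
    (hbc : G.AdjOrEq b c) (hcd : G.AdjOrEq c d) (hda : G.AdjOrEq d a) (hac : ¬ G.AdjOrEq a c) :
    G.AdjOrEq b d := by
  by_contra hbd
  refine hG _ hL
    ⟨fun i => if i = 0 then a else if i = 1 then b else if i = 2 then c else d, ?_⟩
  intro i hi j hj
  simp only at hi
  interval_cases i <;> interval_cases j <;>
    simp [bitAt, cycleFour, hab, hbc, hcd, hda.symm, hac, hbd] <;> decide

/-! ### Nested sets -/

/-- The closed neighborhoods of `u` and `v` are comparable. -/
def Comparable (G : SimpleGraph V) (u v : V) : Prop :=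
  G.closedNbhd u ⊆ G.closedNbhd v ∨ G.closedNbhd v ⊆ G.closedNbhd u

theorem comparable_of_forall {G : SimpleGraph V} {u v : V}
    (h : ∀ w w', G.AdjOrEq u w → ¬ G.AdjOrEq v w → G.AdjOrEq v w' → G.AdjOrEq u w') :
    G.Comparable u v := by
  by_contra hc
  simp only [Comparable, not_or, Set.not_subset, mem_closedNbhd] at hc
  obtain ⟨⟨w, h1, h2⟩, w', h3, h4⟩ := hc
  exact h4 (h w w' h1 h2 h3)

theorem HasNestedOrdering.comparable {G : SimpleGraph V} {S : Set V} (h : G.HasNestedOrdering S)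
    {u v : V} (hu : u ∈ S) (hv : v ∈ S) : G.Comparable u v := by
  obtain ⟨r, s, -, rfl, hs⟩ := h
  obtain ⟨i, rfl⟩ := hu
  obtain ⟨j, rfl⟩ := hv
  exact (le_total i j).elim (fun h => Or.inr (hs i j h)) fun h => Or.inl (hs j i h)

theorem hasNestedOrdering_of_comparable [Finite V] {G : SimpleGraph V} (S : Set V)
    (h : ∀ u ∈ S, ∀ v ∈ S, G.Comparable u v) : G.HasNestedOrdering S := by
  classical
  -- Sorting by reverse inclusion puts the largest closed neighborhoods first.
  let R : S → S → Prop := fun u v => G.closedNbhd v ⊆ G.closedNbhd u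
  have : Std.Total R := ⟨fun u v => (h u u.2 v v.2).symm⟩
  have : IsTrans S R := ⟨fun _ _ _ h1 h2 => h2.trans h1⟩
  have := Fintype.ofFinite S
  let l := (Finset.univ : Finset S).toList.insertionSort R
  have hperm : l.Perm (Finset.univ : Finset S).toList := List.perm_insertionSort _ _
  have hnd : l.Nodup := hperm.nodup_iff.2 (Finset.nodup_toList _)
  have hpw : l.Pairwise R := List.pairwise_insertionSort R _
  refine ⟨l.length, fun i => (l.get i : V), ?_, ?_, ?_⟩
  · exact Subtype.val_injective.comp (List.nodup_iff_injective_get.1 hnd)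
  · ext v
    constructor
    · rintro ⟨i, rfl⟩; exact (l.get i).2
    · intro hv
      have : (⟨v, hv⟩ : S) ∈ l := hperm.mem_iff.2 (by simp)
      obtain ⟨i, hi⟩ := List.get_of_mem this
      exact ⟨i, congrArg Subtype.val hi⟩
  · intro i j hij
    rcases hij.eq_or_lt with rfl | hij
    · exact subset_rfl
    · exact List.pairwise_iff_get.1 hpw i j hij

theorem HasNestedCliquePartition.trans {G : SimpleGraph V} {S : Set V}
    (h : G.HasNestedCliquePartition S) {u v w : V} (hu : u ∈ S) (hv : v ∈ S) (hw : w ∈ S)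
    (huv : G.AdjOrEq u v) (hvw : G.AdjOrEq v w) : G.AdjOrEq u w := by
  obtain ⟨l, P, -, rfl, -, hcl, hanti, -⟩ := h
  obtain ⟨i, hi⟩ := Set.mem_iUnion.1 hu
  obtain ⟨j, hj⟩ := Set.mem_iUnion.1 hv
  obtain ⟨k, hk⟩ := Set.mem_iUnion.1 hw
  rcases huv with rfl | huv
  · exact hvw
  rcases hvw with rfl | hvw
  · exact Or.inr huv
  have hij : i = j := by
    by_contra hne
    exact hanti hne hi hj huv
  have hjk : j = k := by
    by_contra hne
    exact hanti hne hj hk hvw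
  subst hij hjk
  exact isClique_iff_adjOrEq.1 (hcl i) u hi w hk

theorem HasNestedCliquePartition.comparable {G : SimpleGraph V} {S : Set V}
    (h : G.HasNestedCliquePartition S) {u v : V} (hu : u ∈ S) (hv : v ∈ S)
    (huv : G.AdjOrEq u v) : G.Comparable u v := by
  obtain ⟨l, P, -, rfl, -, hcl, hanti, hnest⟩ := h
  obtain ⟨i, hi⟩ := Set.mem_iUnion.1 hu
  obtain ⟨j, hj⟩ := Set.mem_iUnion.1 hv
  rcases huv with rfl | huv
  · exact Or.inl subset_rfl
  have hij : i = j := by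
    by_contra hne
    exact hanti hne hi hj huv
  subst hij
  exact (hnest i).comparable hi hj

/-- The cliques are the classes of closed adjacency, which transitivity makes an equivalence
relation on `S`. -/
theorem hasNestedCliquePartition_of [Finite V] {G : SimpleGraph V} {S : Set V}
    (htrans : ∀ u ∈ S, ∀ v ∈ S, ∀ w ∈ S, G.AdjOrEq u v → G.AdjOrEq v w → G.AdjOrEq u w)
    (hcomp : ∀ u ∈ S, ∀ v ∈ S, G.AdjOrEq u v → G.Comparable u v) :
    G.HasNestedCliquePartition S := by
  let s : Setoid S :=
    ⟨fun u v => G.AdjOrEq u v, fun u => AdjOrEq.refl G _, fun h => h.symm,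
      fun {u v w} h1 h2 => htrans u u.2 v v.2 w w.2 h1 h2⟩
  obtain ⟨l, ⟨e⟩⟩ := Finite.exists_equiv_fin (Quotient s)
  let P : Fin l → Set V := fun i => {v | ∃ h : v ∈ S, e (Quotient.mk s ⟨v, h⟩) = i}
  have hrel : ∀ i, ∀ u ∈ P i, ∀ v ∈ P i, G.AdjOrEq u v := by
    rintro i u ⟨hu, hui⟩ v ⟨hv, hvi⟩
    exact Quotient.exact (e.injective (hui.trans hvi.symm))
  have hsub : ∀ i, P i ⊆ S := fun i v hv => hv.1
  refine ⟨l, P, ?_, ?_, ?_, fun i => isClique_iff_adjOrEq.2 (hrel i), ?_, fun i =>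
    hasNestedOrdering_of_comparable _ fun u hu v hv =>
      hcomp u (hsub i hu) v (hsub i hv) (hrel i u hu v hv)⟩
  · intro i j hij
    refine Set.disjoint_left.2 ?_
    rintro v ⟨hv, hvi⟩ ⟨_, hvj⟩
    exact hij (hvi.symm.trans hvj)
  · ext v
    simp only [Set.mem_iUnion]
    exact ⟨fun ⟨i, hi⟩ => hi.1, fun hv => ⟨_, hv, rfl⟩⟩
  · intro i
    obtain ⟨q, hq⟩ := e.surjective i
    obtain ⟨⟨v, hv⟩, rfl⟩ := Quotient.exists_rep q
    exact ⟨v, hv, hq⟩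
  · rintro i j hij u ⟨hu, hui⟩ v ⟨hv, hvj⟩ huv
    apply hij
    rw [← hui, ← hvj]
    exact congrArg e (Quotient.sound (show s ⟨u, hu⟩ ⟨v, hv⟩ from Or.inr huv))

/-! ### Saucers: the rules and their verification -/

/-- Adjacency between the parts of a saucer with numbers `s ≤ t`. -/
noncomputable def saucerRuleLe (s t : ℕ) (b : Bool) : Bool :=
  Bool.rec
    (Bool.rec
      -- The row of the tables is given by the types of the parts ($X$, $Y$, $Z$ as 0, 1, 2), the
      -- bit by the difference of their indices modulo 7. For instance $67=2^0+2^1+2^6$ says that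
      -- $X_i$ may be adjacent to $X_i$, $X_{i+1}$, $X_{i+6}$. A difference missing in both tables
      -- means that the parts exclude each other.
      (bitOf (entry (Bool.rec [60, 54, 6, 0, 0, 4, 0, 0, 0] [67, 73, 121, 0, 25, 27, 0, 0, 91] b)
        (Nat.add (Nat.mul 3 (Nat.div s 7)) (Nat.div t 7))) (Nat.mod (Nat.sub (Nat.add t 7) s) 7))
      b (Nat.beq t 21))
    (Bool.rec true (Nat.ble 7 s) b) (Nat.beq t 22)

/-- The parts of a saucer are numbered by `0, …, 22` in the order `X`, `Y`, `Z`, `W`, `A`. The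
value of `saucerRule s t b` tells whether vertices of the parts `s` and `t` may be adjacent or equal
(`b = true`) or distinct and nonadjacent (`b = false`). -/
noncomputable def saucerRule (s t : ℕ) (b : Bool) : Bool :=
  Bool.rec (saucerRuleLe t s b) (saucerRuleLe s t b) (Nat.ble s t)

/-- The traces on a seven-cycle of the vertices of the parts of a saucer. -/
def saucerTraces : List ℕ :=
  [67, 7, 14, 28, 56, 112, 97, 19, 38, 76, 25, 50, 100, 73, 31, 62, 124, 121, 115, 103, 79, 127, 0]

theorem saucer_one : ∀ m < 128, (∃ s < 23, saucerTraces.getD s 0 = m) ∨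
    hasPattern forbiddenPatterns (hostBit 7 cycleSeven [m] [1]) 8 = true := by
  decide +kernel

theorem saucer_two : ∀ s < 23, ∀ t < 23, ∀ b : Bool,
    saucerRule s t b = true ∨ hasPattern forbiddenPatterns (hostBit 7 cycleSeven
      [saucerTraces.getD s 0, saucerTraces.getD t 0] (pairMatrix b)) 9 = true := by
  decide +kernel

theorem saucer_three_Y : ∀ i < 7, hasPattern forbiddenPatterns (hostBit 7 cycleSeven
    [saucerTraces.getD (7 + i) 0, saucerTraces.getD (7 + (i + 3) % 7) 0,
      saucerTraces.getD (7 + (i + 4) % 7) 0] (tripleMatrix true true true)) 10 = true := by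
  decide +kernel

/-- An edge between $A$ and $Y_i$ forces $Z_{i+2}=\emptyset$, whether or not the vertex of $A$ sees
the one of $Z_{i+2}$. -/
theorem saucer_A_Y_Z : ∀ i < 7, ∀ c : Bool, hasPattern forbiddenPatterns (hostBit 7 cycleSeven
    [0, saucerTraces.getD (7 + i) 0, saucerTraces.getD (14 + (i + 2) % 7) 0]
      (tripleMatrix true c false)) 10 = true := by
  decide +kernel

/-- An induced path inside $A$ forms a $2P_3$ with a path of the cycle. -/
theorem saucer_A_A_A : hasPattern forbiddenPatterns (hostBit 7 cycleSeven
    [0, 0, 0] (tripleMatrix true false true)) 10 = true := by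
  decide +kernel

/-- The pairs of nonadjacent parts among those parts that may be adjacent to `A`. -/
theorem saucerRule_false : ∀ s < 22, ∀ t < 22, 7 ≤ s ∧ 7 ≤ t ∧ saucerRule s t false = true →
    ∃ i < 7, (s = 7 + i ∧ t = 14 + (i + 2) % 7) ∨ (t = 7 + i ∧ s = 14 + (i + 2) % 7) := by
  decide +kernel

theorem saucerRule_A_X : ∀ s < 7, saucerRule 22 s true = false := by decide +kernel

theorem saucerRule_X_X : ∀ i < 7, ∀ j < 7, ∀ b, saucerRule i j b = true →
    b = bitAt cycleSeven i j := by decide +kernel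

/-- Adjacency between the parts of a saucer other than `A`. -/
noncomputable def saucerRow : Bool → ℕ → ℕ := relRow saucerRule 22

theorem labelable_saucer_cycleFour :
    labelable saucerRow 22 cycleFour 4 0 (List.replicate 4 (2 ^ 22 - 1)) = false := by
  decide +kernel

theorem labelable_saucer_cycleSix :
    labelable saucerRow 22 cycleSix 6 0 (List.replicate 6 (2 ^ 22 - 1)) = false := by
  decide +kernel

theorem labelable_saucer_twoPaths :
    labelable saucerRow 22 twoPaths 6 0 (List.replicate 6 (2 ^ 22 - 1)) = false := by
  decide +kernel

/-- Closed adjacency matrix of a vertex together with a disjoint path on three vertices. -/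
def vertexAndPath : List ℕ := [1, 6, 14, 12]

/-- The first mask restricts the isolated vertex to the labels 14 to 21, that is, to $Z$ and $W$.
Outside $A$, no induced three-vertex path is anticomplete to such a vertex. -/
theorem labelable_saucer_vertexAndPath_Z :
    labelable saucerRow 22 vertexAndPath 4 0
      [2 ^ 22 - 2 ^ 14, 2 ^ 22 - 1, 2 ^ 22 - 1, 2 ^ 22 - 1] = false := by
  decide +kernel

/-- The isolated vertex is in $Y$ and the path in $X$. The parts of $X$ anticomplete to $Y_i$ form
two anticomplete pairs of consecutive parts, whose unions are cliques. -/
theorem labelable_saucer_vertexAndPath_Y :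
    labelable saucerRow 22 vertexAndPath 4 0 [2 ^ 14 - 2 ^ 7, 2 ^ 7 - 1, 2 ^ 7 - 1, 2 ^ 7 - 1]
      = false := by
  decide +kernel

theorem saucerRule_Y_false : ∀ i < 7, ∀ s < 22, saucerRule (7 + i) s false = true →
    s = 14 + (i + 2) % 7 ∨ s < 7 := by decide +kernel

/-! ### Labelings that obey an adjacency rule. -/

theorem exists_bool_iff (p : Prop) : ∃ b : Bool, p ↔ b = true := by
  by_cases h : p
  · exact ⟨true, by simp [h]⟩
  · exact ⟨false, by simp [h]⟩

/-- The labels `c` of the vertices of `G` obey the rule `r` on adjacency. -/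
def ObeysRule (G : SimpleGraph V) (c : V → ℕ) (r : ℕ → ℕ → Bool → Bool) : Prop :=
  ∀ u v b, (G.AdjOrEq u v ↔ b = true) → r (c u) (c v) b = true

section ObeysRule

variable {G : SimpleGraph V} {c : V → ℕ} {r : ℕ → ℕ → Bool → Bool}

theorem ObeysRule.adjOrEq (h : G.ObeysRule c r) {u v : V} (huv : r (c u) (c v) false = false) :
    G.AdjOrEq u v := by
  by_contra hn
  have := h u v false (by simp [hn])
  simp [huv] at this

theorem ObeysRule.not_adjOrEq (h : G.ObeysRule c r) {u v : V} (huv : r (c u) (c v) true = false) :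
    ¬ G.AdjOrEq u v := by
  intro hn
  have := h u v true (by simp [hn])
  simp [huv] at this

theorem ObeysRule.apply_true (h : G.ObeysRule c r) {u v : V} (huv : G.AdjOrEq u v) :
    r (c u) (c v) true = true := h u v true (by simp [huv])

theorem ObeysRule.apply_false (h : G.ObeysRule c r) {u v : V} (huv : ¬ G.AdjOrEq u v) :
    r (c u) (c v) false = true := h u v false (by simp [huv])

theorem ObeysRule.labelable (h : G.ObeysRule c r) {N n : ℕ} {M cs : List ℕ} {f : ℕ → V}
    (hf : ∀ i < n, ∀ j < i, (G.AdjOrEq (f j) (f i) ↔ bitAt M j i = true)) (hcs : cs.length = n)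
    (hc : ∀ i < n, c (f i) < N ∧ (cs.getD i 0).testBit (c (f i)) = true) :
    labelable (relRow r N) N M n 0 cs = true := by
  refine labelable_of_forall n 0 cs hcs (fun i => c (f i)) fun i hi =>
    ⟨(hc i hi).2, (hc i hi).1, fun j hj => ?_⟩
  simp only [relRow, testBit_maskOf, Bool.and_eq_true, zero_add, decide_eq_true_iff]
  exact ⟨(hc i hi).1, h _ _ _ (hf i hi j hj)⟩

theorem ObeysRule.labelable_replicate (h : G.ObeysRule c r) {N n : ℕ} {M : List ℕ} {f : ℕ → V}
    (hf : ∀ i < n, ∀ j < i, (G.AdjOrEq (f j) (f i) ↔ bitAt M j i = true))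
    (hc : ∀ i < n, c (f i) < N) :
    SimpleGraph.labelable (relRow r N) N M n 0 (List.replicate n (2 ^ N - 1)) = true := by
  refine h.labelable hf (by simp) fun i hi => ⟨hc i hi, ?_⟩
  simp [hi, hc i hi]

end ObeysRule

/-- Each of the vertices `i` and `j` of the pattern `M` has a neighbor that is not a neighbor of the
other one. -/
def Incomparable (M : List ℕ) (n i j : ℕ) : Prop :=
  (∃ p < n, bitAt M i p = true ∧ bitAt M j p = false) ∧
    ∃ q < n, bitAt M j q = true ∧ bitAt M i q = false

theorem Incomparable.not_comparable {G : SimpleGraph V} {M : List ℕ} {n i j : ℕ} {f : ℕ → V}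
    (h : Incomparable M n i j) (hf : Realizes G.AdjOrEq f n (bitAt M)) (hi : i < n) (hj : j < n) :
    ¬ G.Comparable (f i) (f j) := by
  obtain ⟨⟨p, hp, hip, hjp⟩, q, hq, hjq, hiq⟩ := h
  rintro (h | h)
  · have := h (mem_closedNbhd.2 ((hf i hi p hp).2 hip))
    rw [mem_closedNbhd, hf j hj p hp] at this
    simp [hjp] at this
  · have := h (mem_closedNbhd.2 ((hf j hj q hq).2 hjq))
    rw [mem_closedNbhd, hf i hi q hq] at this
    simp [hiq] at this

/-! ### Labelings of saucers -/

/-- The labeling `c` of the vertices of `G` by the numbers of the parts satisfies the conditions on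
a seven-saucer, except for the partition of `A` into nested cliques. -/
structure IsSaucerLabeling (G : SimpleGraph V) (c : V → ℕ) : Prop where
  lt : ∀ v, c v < 23
  surj : ∀ i < 7, ∃ v, c v = i
  rule : G.ObeysRule c saucerRule
  not_three_Y : ∀ i < 7, ∀ u v w, c u = 7 + i → c v = 7 + (i + 3) % 7 → c w = 7 + (i + 4) % 7 →
    False
  A_Y_or : ∀ i < 7, (∀ a y, c a = 22 → c y = 7 + i → ¬ G.AdjOrEq a y) ∨
    ∀ z, c z ≠ 14 + (i + 2) % 7

section SaucerLabeling

variable {G : SimpleGraph V} {c : V → ℕ}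

theorem IsSaucerLabeling.le_of_adjOrEq (h : G.IsSaucerLabeling c) {a u : V} (ha : c a = 22)
    (hau : G.AdjOrEq a u) : 7 ≤ c u := by
  by_contra hu
  have := h.rule.apply_true hau
  rw [ha, saucerRule_A_X _ (not_le.1 hu)] at this
  simp at this

theorem IsSaucerLabeling.lt_of_ne (h : G.IsSaucerLabeling c) {u : V} (hu : c u ≠ 22) :
    c u < 22 := by
  have := h.lt u
  omega

/-- The neighbors of $A$ outside $A$ form a clique. They lie in $Y$, $Z$ and $W$, where only pairs
from $Y_i$ and $Z_{i+2}$ are nonadjacent; but $Z_{i+2}$ is empty as soon as $A$ has a neighbor in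
$Y_i$. -/
theorem IsSaucerLabeling.adjOrEq_of_A (h : G.IsSaucerLabeling c) {a a' u w : V} (ha : c a = 22)
    (ha' : c a' = 22) (hu : c u ≠ 22) (hw : c w ≠ 22) (hau : G.AdjOrEq a u)
    (haw : G.AdjOrEq a' w) : G.AdjOrEq u w := by
  by_contra huw
  obtain ⟨i, hi, h1 | h1⟩ := saucerRule_false _ (h.lt_of_ne hu) _ (h.lt_of_ne hw)
    ⟨h.le_of_adjOrEq ha hau, h.le_of_adjOrEq ha' haw, h.rule.apply_false huw⟩
  · exact (h.A_Y_or i hi).elim (fun h2 => h2 a u ha h1.1 hau) fun h2 => h2 w h1.2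
  · exact (h.A_Y_or i hi).elim (fun h2 => h2 a' w ha' h1.1 haw) fun h2 => h2 u h1.2

/-- A pattern vertex in $A$ would have two nonadjacent neighbors, both incomparable to it and hence
outside $A$. The neighbors of $A$ outside $A$ form a clique, a contradiction, so the 22 other labels
suffice. -/
theorem IsSaucerLabeling.labelable_cycle (h : G.IsSaucerLabeling c)
    (hA : G.HasNestedCliquePartition {v | c v = 22}) {n : ℕ} {M : List ℕ} {f : ℕ → V}
    (hf : Realizes G.AdjOrEq f n (bitAt M))
    (hM : ∀ i < n, ∃ j < n, ∃ k < n, (bitAt M i j = true ∧ bitAt M i k = true ∧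
      bitAt M j k = false) ∧ Incomparable M n i j ∧ Incomparable M n i k) :
    labelable (relRow saucerRule 22) 22 M n 0 (List.replicate n (2 ^ 22 - 1)) = true := by
  refine h.rule.labelable_replicate (fun i hi j hj => hf j (hj.trans hi) i hi) fun i hi =>
    h.lt_of_ne fun hiA => ?_
  obtain ⟨j, hj, k, hk, ⟨hij, hik, hjk⟩, h1, h2⟩ := hM i hi
  have hij' := (hf i hi j hj).2 hij
  have hik' := (hf i hi k hk).2 hik
  have hjA : c (f j) ≠ 22 := fun hjA =>
    h1.not_comparable hf hi hj (hA.comparable hiA hjA hij')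
  have hkA : c (f k) ≠ 22 := fun hkA =>
    h2.not_comparable hf hi hk (hA.comparable hiA hkA hik')
  have := h.adjOrEq_of_A hiA hiA hjA hkA hij' hik'
  rw [hf j hj k hk, hjk] at this
  simp at this

/-- As `u` is adjacent to every other outside neighbor of $A$, a path that meets $A$ and is
anticomplete to `u` stays in $A$, where adjacency is transitive. So the path lies outside $A$, and
the finite search applies. -/
theorem IsSaucerLabeling.false_of_path (h : G.IsSaucerLabeling c)
    (hA : G.HasNestedCliquePartition {v | c v = 22}) {a u x y z : V} (ha : c a = 22)
    (hu : c u ≠ 22) (hau : G.AdjOrEq a u) (hxy : G.AdjOrEq x y) (hyz : G.AdjOrEq y z)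
    (hxz : ¬ G.AdjOrEq x z) (hux : ¬ G.AdjOrEq u x) (huy : ¬ G.AdjOrEq u y)
    (huz : ¬ G.AdjOrEq u z) : False := by
  have key : ∀ s t, G.AdjOrEq s t → ¬ G.AdjOrEq u t → c s = 22 → c t = 22 := by
    intro s t hst hut hs
    by_contra ht
    exact hut (h.adjOrEq_of_A ha hs hu ht hau hst)
  have hx : c x ≠ 22 := fun hx => by
    have hy := key x y hxy huy hx
    exact hxz (hA.trans hx hy (key y z hyz huz hy) hxy hyz)
  have hy : c y ≠ 22 := fun hy => hx (key y x hxy.symm hux hy)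
  have hz : c z ≠ 22 := fun hz => hy (key z y hyz.symm huy hz)
  have hf : ∀ i < 4, ∀ j < i,
      (G.AdjOrEq ((fun i => if i = 0 then u else if i = 1 then x else if i = 2 then y else z) j)
        ((fun i => if i = 0 then u else if i = 1 then x else if i = 2 then y else z) i) ↔
        bitAt vertexAndPath j i = true) := by
    intro i hi j hj
    interval_cases i <;> interval_cases j <;>
      simp [hux, huy, huz, hxy, hyz, hxz] <;> decide
  have hu22 := h.lt_of_ne hu
  have hx22 := h.lt_of_ne hx
  have hy22 := h.lt_of_ne hy
  have hz22 := h.lt_of_ne hz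
  have hu7 := h.le_of_adjOrEq ha hau
  rcases lt_or_ge (c u) 14 with hu14 | hu14
  · obtain ⟨i, hi⟩ := Nat.exists_eq_add_of_le hu7
    have hi7 : i < 7 := by omega
    -- Outside $A$, a nonneighbor of $u\in Y_i$ lies in $X$ or $Z_{i+2}$, and the edge `a`–`u` makes
    -- $Z_{i+2}$ empty.
    have hX : ∀ t, c t < 22 → ¬ G.AdjOrEq u t → c t < 7 := by
      intro t ht hut
      have := h.rule.apply_false hut
      rw [hi] at this
      refine (saucerRule_Y_false i hi7 _ ht this).resolve_left fun h1 => ?_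
      exact (h.A_Y_or i hi7).elim (fun h2 => h2 a u ha hi hau) fun h2 => h2 t h1
    have h1 := hX x hx22 hux
    have h2 := hX y hy22 huy
    have h3 := hX z hz22 huz
    have hbit : ∀ s, 7 ≤ s → s < 14 → (2 ^ 14 - 2 ^ 7).testBit s = true := by decide
    have hbit' : ∀ s, s < 7 → (2 ^ 7 - 1).testBit s = true := by decide
    have := h.rule.labelable (N := 22) hf
      (cs := [2 ^ 14 - 2 ^ 7, 2 ^ 7 - 1, 2 ^ 7 - 1, 2 ^ 7 - 1]) rfl fun i hi => by
        interval_cases i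
        · exact ⟨hu22, hbit _ hu7 hu14⟩
        · exact ⟨hx22, hbit' _ h1⟩
        · exact ⟨hy22, hbit' _ h2⟩
        · exact ⟨hz22, hbit' _ h3⟩
    exact Bool.false_ne_true (labelable_saucer_vertexAndPath_Y.symm.trans this)
  · have hbit : ∀ s, 14 ≤ s → s < 22 → (2 ^ 22 - 2 ^ 14).testBit s = true := by decide
    have hbit' : ∀ s, s < 22 → (2 ^ 22 - 1).testBit s = true := by decide
    have := h.rule.labelable (N := 22) hf
      (cs := [2 ^ 22 - 2 ^ 14, 2 ^ 22 - 1, 2 ^ 22 - 1, 2 ^ 22 - 1]) rfl fun i hi => by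
        interval_cases i
        · exact ⟨hu22, hbit _ hu14 hu22⟩
        · exact ⟨hx22, hbit' _ hx22⟩
        · exact ⟨hy22, hbit' _ hy22⟩
        · exact ⟨hz22, hbit' _ hz22⟩
    exact Bool.false_ne_true (labelable_saucer_vertexAndPath_Z.symm.trans this)

/-- Neither of two disjoint and anticomplete paths on three vertices meets `A`. -/
theorem IsSaucerLabeling.ne_of_paths (h : G.IsSaucerLabeling c)
    (hA : G.HasNestedCliquePartition {v | c v = 22}) {p q r x y z : V} (hpq : G.AdjOrEq p q)
    (hqr : G.AdjOrEq q r) (hpr : ¬ G.AdjOrEq p r) (hxy : G.AdjOrEq x y) (hyz : G.AdjOrEq y z)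
    (hxz : ¬ G.AdjOrEq x z)
    (hanti : ∀ s ∈ ({p, q, r} : Set V), ∀ t ∈ ({x, y, z} : Set V), ¬ G.AdjOrEq s t) :
    c p ≠ 22 ∧ c q ≠ 22 ∧ c r ≠ 22 := by
  have key : ∀ a ∈ ({p, q, r} : Set V), ∀ u ∈ ({p, q, r} : Set V), G.AdjOrEq a u → c a = 22 →
      c u = 22 := by
    intro a _ u hu hau ha
    by_contra hu'
    exact h.false_of_path hA ha hu' hau hxy hyz hxz (hanti u hu x (by simp))
      (hanti u hu y (by simp)) (hanti u hu z (by simp))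
  have hq : c q ≠ 22 := fun hq =>
    hpr (hA.trans (key q (by simp) p (by simp) hpq.symm hq) hq
      (key q (by simp) r (by simp) hqr hq) hpq hqr)
  exact ⟨fun hp => hq (key p (by simp) q (by simp) hpq hp), hq,
    fun hr => hq (key r (by simp) q (by simp) hqr.symm hr)⟩

theorem IsSaucerLabeling.avoidsPatterns (h : G.IsSaucerLabeling c)
    (hA : G.HasNestedCliquePartition {v | c v = 22}) : G.AvoidsPatterns forbiddenPatterns := by
  simp only [AvoidsPatterns, forbiddenPatterns, List.forall_mem_cons]
  refine ⟨fun ho => ?_, fun ho => ?_, fun ho => ?_, by simp⟩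
  · obtain ⟨f, hf⟩ := ho.realizes (by decide) (by decide)
    have := h.labelable_cycle hA hf (by unfold Incomparable; decide)
    exact Bool.false_ne_true (labelable_saucer_cycleFour.symm.trans this)
  · obtain ⟨f, hf⟩ := ho.realizes (by decide) (by decide)
    have adj : ∀ i j, i < 6 ∧ j < 6 ∧ bitAt twoPaths i j = true → G.AdjOrEq (f i) (f j) :=
      fun i j h => (hf i h.1 j h.2.1).2 h.2.2
    have nadj : ∀ i j, i < 6 ∧ j < 6 ∧ bitAt twoPaths i j = false → ¬ G.AdjOrEq (f i) (f j) := by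
      intro i j h h'
      rw [hf i h.1 j h.2.1, h.2.2] at h'
      simp at h'
    have h1 := h.ne_of_paths hA (adj 0 1 (by decide)) (adj 1 2 (by decide))
      (nadj 0 2 (by decide)) (adj 3 4 (by decide)) (adj 4 5 (by decide)) (nadj 3 5 (by decide)) (by
        rintro s (rfl | rfl | rfl) t (rfl | rfl | rfl) <;> exact nadj _ _ (by decide))
    have h2 := h.ne_of_paths hA (adj 3 4 (by decide)) (adj 4 5 (by decide))
      (nadj 3 5 (by decide)) (adj 0 1 (by decide)) (adj 1 2 (by decide)) (nadj 0 2 (by decide)) (by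
        rintro s (rfl | rfl | rfl) t (rfl | rfl | rfl) <;> exact nadj _ _ (by decide))
    have := h.rule.labelable_replicate (N := 22) (fun i hi j hj => hf j (hj.trans hi) i hi)
      fun i hi => by
        interval_cases i
        exacts [h.lt_of_ne h1.1, h.lt_of_ne h1.2.1, h.lt_of_ne h1.2.2, h.lt_of_ne h2.1,
          h.lt_of_ne h2.2.1, h.lt_of_ne h2.2.2]
    exact Bool.false_ne_true (labelable_saucer_twoPaths.symm.trans this)
  · obtain ⟨f, hf⟩ := ho.realizes (by decide) (by decide)
    have := h.labelable_cycle hA hf (by unfold Incomparable; decide)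
    exact Bool.false_ne_true (labelable_saucer_cycleSix.symm.trans this)

theorem IsSaucerLabeling.occurs_cycleSeven (h : G.IsSaucerLabeling c) :
    G.Occurs 7 cycleSeven := by
  -- For $i\ge 7$ a vertex of $X_0$ serves as default value, so that the choice is total.
  have hex : ∀ i, ∃ v, i < 7 → c v = i := fun i => by
    by_cases hi : i < 7
    · exact (h.surj i hi).imp fun v hv _ => hv
    · exact (h.surj 0 (by norm_num)).imp fun v _ hi' => absurd hi' hi
  choose x hx using hex
  refine ⟨x, fun i hi j hj => ?_⟩
  obtain ⟨b, hb⟩ := exists_bool_iff (G.AdjOrEq (x j) (x i))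
  have := h.rule _ _ _ hb
  rw [hx i hi, hx j (hj.trans hi)] at this
  rw [hb, saucerRule_X_X j (hj.trans hi) i hi b this]

theorem saucerTraces_injective : ∀ s < 23, ∀ t < 23,
    saucerTraces.getD s 0 = saucerTraces.getD t 0 → s = t := by
  decide +kernel

theorem exists_isSaucerLabeling [Finite V] (hG : G.AvoidsPatterns forbiddenPatterns)
    (ho : G.Occurs 7 cycleSeven) :
    ∃ c, G.IsSaucerLabeling c ∧ G.HasNestedCliquePartition {v | c v = 22} := by
  obtain ⟨x, hx⟩ := ho.realizes (by decide) (by decide)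
  have hex : ∀ v, ∃ s < 23, saucerTraces.getD s 0 = G.trace x 7 v := fun v =>
    (saucer_one _ (trace_lt G x 7 v)).resolve_right (by simp [hG.extend_one hx v])
  choose c hlt hc using hex
  have hrule : G.ObeysRule c saucerRule := by
    intro u v b hb
    have := hG.extend_two hx hb
    rw [← hc u, ← hc v] at this
    exact (saucer_two _ (hlt u) _ (hlt v) b).resolve_right fun h =>
      Bool.false_ne_true (this.symm.trans h)
  have hA : ∀ a, c a = 22 → G.trace x 7 a = 0 := fun a ha => by
    rw [← hc a, ha]; rfl
  have hlab : G.IsSaucerLabeling c := by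
    refine ⟨hlt, fun i hi => ⟨x i, ?_⟩, hrule, ?_, ?_⟩
    · refine saucerTraces_injective _ (hlt _) _ (by omega) ?_
      rw [hc, trace_base hx hi]
      · interval_cases i <;> rfl
      · interval_cases i <;> decide
    · intro i hi u v w hu hv hw
      have huv : G.AdjOrEq u v := hrule.adjOrEq (by
        rw [hu, hv]; clear hu hv hw; revert i; decide +kernel)
      have huw : G.AdjOrEq u w := hrule.adjOrEq (by
        rw [hu, hw]; clear hu hv hw; revert i; decide +kernel)
      -- The indices of `v` and `w` differ by 1, so the rule rejects both truth values and either
      -- could be derived here.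
      have hvw : G.AdjOrEq v w := hrule.adjOrEq (by
        rw [hv, hw]; clear hu hv hw; revert i; decide +kernel)
      have := hG.extend_three hx (iff_of_true huv rfl) (iff_of_true huw rfl) (iff_of_true hvw rfl)
      rw [← hc u, ← hc v, ← hc w, hu, hv, hw, saucer_three_Y i hi] at this
      simp at this
    · intro i hi
      by_contra! hcon
      obtain ⟨⟨a, y, ha, hy, hay⟩, z, hz⟩ := hcon
      obtain ⟨b, hb⟩ := exists_bool_iff (G.AdjOrEq a z)
      have hyz : ¬ G.AdjOrEq y z := hrule.not_adjOrEq (by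
        rw [hy, hz]; clear hy hz; revert i; decide +kernel)
      have := hG.extend_three hx (iff_of_true hay rfl) hb
        (iff_of_false hyz Bool.false_ne_true)
      rw [hA a ha, ← hc y, ← hc z, hy, hz, saucer_A_Y_Z i hi] at this
      simp at this
  have htrans : ∀ u ∈ {v | c v = 22}, ∀ v ∈ {v | c v = 22}, ∀ w ∈ {v | c v = 22},
      G.AdjOrEq u v → G.AdjOrEq v w → G.AdjOrEq u w := by
    intro u hu v hv w hw huv hvw
    by_contra huw
    have := hG.extend_three hx (iff_of_true huv rfl) (iff_of_false huw Bool.false_ne_true)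
      (iff_of_true hvw rfl)
    rw [hA u hu, hA v hv, hA w hw, saucer_A_A_A] at this
    simp at this
  refine ⟨c, hlab, hasNestedCliquePartition_of htrans fun a ha a' ha' haa => ?_⟩
  refine comparable_of_forall fun w w' haw haw' hww => ?_
  by_contra hn
  -- Private neighbors `w` of `a` and `w'` of `a'` lie outside $A$, hence are adjacent, and `a`,
  -- `w`, `w'`, `a'` is an induced four-cycle.
  have hw : c w ≠ 22 := fun hw => haw' (htrans a' ha' a ha w hw haa.symm haw)
  have hw' : c w' ≠ 22 := fun hw' => hn (htrans a ha a' ha' w' hw' haa hww)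
  exact haw' (hG.four_cycle (by simp [forbiddenPatterns]) haw
    (hlab.adjOrEq_of_A ha ha' hw hw' haw hww) hww.symm haa.symm hn).symm

end SaucerLabeling

/-! ### Passing between saucer partitions and labelings. -/

namespace SpecialPart

/-- The numbers of the parts of a special partition. -/
def num : SpecialPart → ℕ
  | X i => i.val
  | Y i => 7 + i.val
  | Z i => 14 + i.val
  | W => 21

theorem num_lt (p : SpecialPart) : p.num < 22 := by
  rcases p with i | i | i | _ <;> first | (have := ZMod.val_lt i; simp only [num]; omega) | decide

theorem num_injective : Function.Injective num := by
  rintro (i | i | i | _) (j | j | j | _) h <;> simp only [num] at h <;>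
    first
    | (have := ZMod.val_lt i; have := ZMod.val_lt j
       first
       | omega
       | (obtain rfl : i = j := ZMod.val_injective 7 (by omega); rfl))
    | (have := ZMod.val_lt i; omega)
    | (have := ZMod.val_lt j; omega)
    | rfl

theorem exists_num_eq : ∀ {n : ℕ}, n < 22 → ∃ p : SpecialPart, p.num = n := by
  intro n hn
  rcases lt_or_ge n 7 with h | h
  · exact ⟨X (n : ZMod 7), ZMod.val_cast_of_lt h⟩
  rcases lt_or_ge n 14 with h' | h'
  · refine ⟨Y ((n - 7 : ℕ) : ZMod 7), ?_⟩
    rw [num, ZMod.val_cast_of_lt (by omega)]; omega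
  rcases lt_or_ge n 21 with h'' | h''
  · refine ⟨Z ((n - 14 : ℕ) : ZMod 7), ?_⟩
    rw [num, ZMod.val_cast_of_lt (by omega)]; omega
  · exact ⟨W, by simp only [num]; omega⟩

end SpecialPart

section SpecialPartition

open SpecialPart

variable {G : SimpleGraph V} {c : V → ℕ}

theorem ObeysRule.isCompleteBetween {r : ℕ → ℕ → Bool → Bool} (h : G.ObeysRule c r) {m n : ℕ}
    (hr : r m n false = false ∧ m ≠ n) : G.IsCompleteBetween {v | c v = m} {v | c v = n} := by
  rintro u (rfl : c u = m) v (rfl : c v = n)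
  exact (h.adjOrEq hr.1).adj fun huv => hr.2 (congrArg c huv)

theorem ObeysRule.isAnticompleteBetween {r : ℕ → ℕ → Bool → Bool} (h : G.ObeysRule c r) {m n : ℕ}
    (hr : r m n true = false) : G.IsAnticompleteBetween {v | c v = m} {v | c v = n} := by
  rintro u (rfl : c u = m) v (rfl : c v = n) huv
  exact h.not_adjOrEq hr (Or.inr huv)

/-- Any two vertices are either adjacent or equal, or neither. If the rule rejects both
possibilities, the parts cannot coexist. -/
theorem ObeysRule.eq_empty {r : ℕ → ℕ → Bool → Bool} (h : G.ObeysRule c r) {m n : ℕ}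
    (hne : {v | c v = m}.Nonempty) (hr : ∀ b, r m n b = false) : {v | c v = n} = ∅ := by
  obtain ⟨u, rfl : c u = m⟩ := hne
  rw [Set.eq_empty_iff_forall_notMem]
  rintro v (rfl : c v = n)
  obtain ⟨b, hb⟩ := exists_bool_iff (G.AdjOrEq u v)
  exact Bool.false_ne_true ((hr b).symm.trans (h u v b hb))

theorem ObeysRule.isClique {r : ℕ → ℕ → Bool → Bool} (h : G.ObeysRule c r) {m : ℕ}
    (hr : r m m false = false) : G.IsClique {v | c v = m} := by
  rw [isClique_iff_adjOrEq]
  rintro u (rfl : c u = m) v (hv : c v = c u)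
  exact h.adjOrEq (by rw [hv, hr])

theorem IsSaucerLabeling.isSevenSaucerPartition (h : G.IsSaucerLabeling c)
    (hA : G.HasNestedCliquePartition {v | c v = 22}) :
    G.IsSevenSaucerPartition (fun p => {v | c v = p.num}) {v | c v = 22} where
  special :=
    { disjoint := fun p q hpq => Set.disjoint_left.2 fun v hp hq =>
        hpq (num_injective ((show c v = _ from hp).symm.trans hq))
      union := by
        ext v
        simp only [Set.mem_iUnion, Set.mem_ofPred_eq, Set.mem_compl_iff]
        constructor
        · rintro ⟨p, hp⟩
          exact hp ▸ (num_lt p).ne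
        · intro hv
          obtain ⟨p, hp⟩ := exists_num_eq (h.lt_of_ne hv)
          exact ⟨p, hp.symm⟩
      clique := fun p => h.rule.isClique
        ((by decide +kernel : ∀ n < 22, saucerRule n n false = false) _ (num_lt p))
      X_nonempty := fun i => h.surj _ (ZMod.val_lt i)
      X_complete_X := fun i k hk => h.rule.isCompleteBetween
        ((by decide +kernel : ∀ i k : ZMod 7, k = -1 ∨ k = 1 →
          saucerRule (X i).num (X (i + k)).num false = false ∧ (X i).num ≠ (X (i + k)).num) i k hk)
      X_anticomplete_X := fun i k hk => h.rule.isAnticompleteBetween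
        ((by decide +kernel : ∀ i k : ZMod 7, k = 2 ∨ k = 3 ∨ k = 4 ∨ k = 5 →
          saucerRule (X i).num (X (i + k)).num true = false) i k hk)
      X_complete_Y := fun i k hk => h.rule.isCompleteBetween
        ((by decide +kernel : ∀ i k : ZMod 7, k = 0 ∨ k = 3 ∨ k = 6 →
          saucerRule (X i).num (Y (i + k)).num false = false ∧ (X i).num ≠ (Y (i + k)).num) i k hk)
      X_complete_Z := fun i k hk => h.rule.isCompleteBetween
        ((by decide +kernel : ∀ i k : ZMod 7, k = 0 ∨ k = 3 ∨ k = 4 ∨ k = 5 ∨ k = 6 →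
          saucerRule (X i).num (Z (i + k)).num false = false ∧ (X i).num ≠ (Z (i + k)).num) i k hk)
      X_complete_W := fun i => h.rule.isCompleteBetween
        ((by decide +kernel : ∀ i : ZMod 7,
          saucerRule (X i).num W.num false = false ∧ (X i).num ≠ W.num) i)
      X_anticomplete_Y := fun i k hk => h.rule.isAnticompleteBetween
        ((by decide +kernel : ∀ i k : ZMod 7, k = 1 ∨ k = 2 ∨ k = 4 ∨ k = 5 →
          saucerRule (X i).num (Y (i + k)).num true = false) i k hk)
      X_anticomplete_Z := fun i k hk => h.rule.isAnticompleteBetween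
        ((by decide +kernel : ∀ i k : ZMod 7, k = 1 ∨ k = 2 →
          saucerRule (X i).num (Z (i + k)).num true = false) i k hk)
      Y_empty := fun i hi => by
        refine ⟨fun k hk => h.rule.eq_empty hi
            ((by decide +kernel : ∀ i k : ZMod 7, k = 1 ∨ k = 2 ∨ k = 5 ∨ k = 6 → ∀ b,
              saucerRule (Y i).num (Y (i + k)).num b = false) i k hk),
          fun k hk => h.rule.eq_empty hi
            ((by decide +kernel : ∀ i k : ZMod 7, k = 5 ∨ k = 6 → ∀ b,
              saucerRule (Y i).num (Z (i + k)).num b = false) i k hk), ?_⟩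
        by_contra! hcon
        obtain ⟨⟨v, hv⟩, w, hw⟩ := hcon
        obtain ⟨u, hu⟩ := hi
        refine h.not_three_Y i.val (ZMod.val_lt i) u v w hu (hv.trans ?_) (hw.trans ?_)
        · clear hu hv hw; revert i; decide
        · clear hu hv hw; revert i; decide
      Z_empty := fun i hi => ⟨h.rule.eq_empty hi
          ((by decide +kernel : ∀ i : ZMod 7, ∀ b,
            saucerRule (Z i).num (Z (i + 2)).num b = false) i),
        h.rule.eq_empty hi
          ((by decide +kernel : ∀ i : ZMod 7, ∀ b,
            saucerRule (Z i).num (Z (i + 5)).num b = false) i)⟩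
      Y_complete_Y := fun i k hk => h.rule.isCompleteBetween
        ((by decide +kernel : ∀ i k : ZMod 7, k = 3 ∨ k = 4 →
          saucerRule (Y i).num (Y (i + k)).num false = false ∧ (Y i).num ≠ (Y (i + k)).num) i k hk)
      Y_complete_Z := fun i k hk => h.rule.isCompleteBetween
        ((by decide +kernel : ∀ i k : ZMod 7, k = 0 ∨ k = 1 ∨ k = 3 ∨ k = 4 →
          saucerRule (Y i).num (Z (i + k)).num false = false ∧ (Y i).num ≠ (Z (i + k)).num) i k hk)
      Y_complete_W := fun i => h.rule.isCompleteBetween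
        ((by decide +kernel : ∀ i : ZMod 7,
          saucerRule (Y i).num W.num false = false ∧ (Y i).num ≠ W.num) i)
      Y_anticomplete_Z := fun i => h.rule.isAnticompleteBetween
        ((by decide +kernel : ∀ i : ZMod 7,
          saucerRule (Y i).num (Z (i + 2)).num true = false) i)
      Z_complete_Z := fun i k hk => h.rule.isCompleteBetween
        ((by decide +kernel : ∀ i k : ZMod 7, k = 1 ∨ k = 3 ∨ k = 4 ∨ k = 6 →
          saucerRule (Z i).num (Z (i + k)).num false = false ∧ (Z i).num ≠ (Z (i + k)).num) i k hk)
      Z_complete_W := fun i => h.rule.isCompleteBetween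
        ((by decide +kernel : ∀ i : ZMod 7,
          saucerRule (Z i).num W.num false = false ∧ (Z i).num ≠ W.num) i) }
  A_anticomplete_X := fun i => h.rule.isAnticompleteBetween
    (saucerRule_A_X _ (ZMod.val_lt i))
  A_anticomplete_Y_or := fun i => by
    refine (h.A_Y_or i.val (ZMod.val_lt i)).imp ?_ ?_
    · intro h1 a ha y hy hay
      exact h1 a y ha hy (Or.inr hay)
    · intro h1
      rw [Set.eq_empty_iff_forall_notMem]
      intro z hz
      refine h1 z (hz.trans ?_)
      clear h1 hz; revert i; decide
  A_nested := hA

theorem saucerRule_comm : ∀ s < 23, ∀ t < 23, ∀ b, saucerRule s t b = saucerRule t s b := by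
  decide +kernel

/-- The numbers of the parts of a saucer, where `none` stands for the part `A`. -/
def saucerNum : Option SpecialPart → ℕ
  | none => 22
  | some p => p.num

theorem saucerNum_lt (p : Option SpecialPart) : saucerNum p < 23 := by
  cases p with
  | none => decide
  | some p => exact (num_lt p).trans (by norm_num)

/-- The parts of a saucer, where `none` stands for the part `A`. -/
def saucerParts (P : SpecialPart → Set V) (A : Set V) : Option SpecialPart → Set V
  | none => A
  | some p => P p

variable {P : SpecialPart → Set V} {A : Set V}

theorem IsSevenSaucerPartition.part_unique (H : G.IsSevenSaucerPartition P A) {v : V}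
    {p q : Option SpecialPart} (hp : v ∈ saucerParts P A p) (hq : v ∈ saucerParts P A q) :
    p = q := by
  have hA : ∀ r, v ∈ P r → v ∉ A := fun r hr => by
    have : v ∈ ⋃ p, P p := Set.mem_iUnion.2 ⟨r, hr⟩
    rwa [H.special.union] at this
  rcases p with _ | p <;> rcases q with _ | q
  · rfl
  · exact absurd hp (hA q hq)
  · exact absurd hq (hA p hp)
  · by_contra hne
    exact Set.disjoint_left.1 (H.special.disjoint fun h => hne (congrArg some h)) hp hq

theorem IsSevenSaucerPartition.exists_part (H : G.IsSevenSaucerPartition P A) (v : V) :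
    ∃ p, v ∈ saucerParts P A p := by
  by_cases hv : v ∈ A
  · exact ⟨none, hv⟩
  · have : v ∈ ⋃ p, P p := by rwa [H.special.union]
    obtain ⟨p, hp⟩ := Set.mem_iUnion.1 this
    exact ⟨some p, hp⟩

theorem IsSevenSaucerPartition.eq_false (H : G.IsSevenSaucerPartition P A)
    {p q : Option SpecialPart} {u v : V} {b : Bool} (hu : u ∈ saucerParts P A p)
    (hv : v ∈ saucerParts P A q) (hb : G.AdjOrEq u v ↔ b = true) (hpq : p ≠ q)
    (h : G.IsAnticompleteBetween (saucerParts P A p) (saucerParts P A q)) : b = false := by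
  rw [← Bool.not_eq_true, ← hb]
  rintro (rfl | huv)
  · exact hpq (H.part_unique hu hv)
  · exact h hu hv huv

theorem IsSevenSaucerPartition.saucerRule_some (H : G.IsSevenSaucerPartition P A)
    {p q : SpecialPart} {u v : V} {b : Bool} (hu : u ∈ P p)
    (hv : v ∈ P q) (hb : G.AdjOrEq u v ↔ b = true) : saucerRule p.num q.num b = true := by
  have S := H.special
  have one : G.IsCompleteBetween (P p) (P q) → b = true := fun h => hb.1 (Or.inr (h hu hv))
  have zero : p ≠ q → G.IsAnticompleteBetween (P p) (P q) → b = false := fun hpq h =>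
    H.eq_false (p := some p) (q := some q) hu hv hb (by simpa using hpq) h
  have clique : p = q → b = true := fun h =>
    hb.1 (isClique_iff_adjOrEq.1 (S.clique q) u (h ▸ hu) v hv)
  have empty : P q = ∅ → False := fun h => by simp [h] at hv
  have comm : saucerRule q.num p.num b = true → saucerRule p.num q.num b = true := fun h => by
    rwa [saucerRule_comm _ ((num_lt p).trans (by norm_num)) _ ((num_lt q).trans (by norm_num))]
  have hb' := adjOrEq_comm.trans hb
  have one' : G.IsCompleteBetween (P q) (P p) → b = true := fun h => hb'.1 (Or.inr (h hv hu))
  have zero' : q ≠ p → G.IsAnticompleteBetween (P q) (P p) → b = false := fun hpq h =>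
    H.eq_false (p := some q) (q := some p) hv hu hb' (by simpa using hpq) h
  have empty' : P p = ∅ → False := fun h => by simp [h] at hu
  have XW : ∀ i : ZMod 7, saucerRule (X i).num W.num true = true := by decide +kernel
  have YW : ∀ i : ZMod 7, saucerRule (Y i).num W.num true = true := by decide +kernel
  have ZW : ∀ i : ZMod 7, saucerRule (Z i).num W.num true = true := by decide +kernel
  -- The rule depends on indices only through their difference `k`. Each of the next facts takes the
  -- defining conditions as hypotheses, one per set of differences; those ending in `False` stand
  -- for parts that exclude each other.
  have XX : ∀ i k : ZMod 7, ∀ b, (k = 0 → b = true) → (k = -1 ∨ k = 1 → b = true) →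
      (k = 2 ∨ k = 3 ∨ k = 4 ∨ k = 5 → b = false) →
      saucerRule (X i).num (X (i + k)).num b = true := by decide +kernel
  have XY : ∀ i k : ZMod 7, ∀ b, (k = 0 ∨ k = 3 ∨ k = 6 → b = true) →
      (k = 1 ∨ k = 2 ∨ k = 4 ∨ k = 5 → b = false) →
      saucerRule (X i).num (Y (i + k)).num b = true := by decide +kernel
  have XZ : ∀ i k : ZMod 7, ∀ b, (k = 0 ∨ k = 3 ∨ k = 4 ∨ k = 5 ∨ k = 6 → b = true) →
      (k = 1 ∨ k = 2 → b = false) →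
      saucerRule (X i).num (Z (i + k)).num b = true := by decide +kernel
  have YY : ∀ i k : ZMod 7, ∀ b, (k = 0 → b = true) → (k = 3 ∨ k = 4 → b = true) →
      (k = 1 ∨ k = 2 ∨ k = 5 ∨ k = 6 → False) →
      saucerRule (Y i).num (Y (i + k)).num b = true := by decide +kernel
  have YZ : ∀ i k : ZMod 7, ∀ b, (k = 0 ∨ k = 1 ∨ k = 3 ∨ k = 4 → b = true) →
      (k = 2 → b = false) → (k = 5 ∨ k = 6 → False) →
      saucerRule (Y i).num (Z (i + k)).num b = true := by decide +kernel
  have ZZ : ∀ i k : ZMod 7, ∀ b, (k = 0 → b = true) →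
      (k = 1 ∨ k = 3 ∨ k = 4 ∨ k = 6 → b = true) → (k = 2 → False) → (k = 5 → False) →
      saucerRule (Z i).num (Z (i + k)).num b = true := by decide +kernel
  have hne : ∀ i k : ZMod 7, (k = 2 ∨ k = 3 ∨ k = 4 ∨ k = 5) → i ≠ i + k := by decide
  have hadd : ∀ i j : ZMod 7, ∃ k, j = i + k := fun i j => ⟨j - i, by ring⟩
  rcases p with i | i | i | _ <;> rcases q with j | j | j | _
  · obtain ⟨k, rfl⟩ := hadd i j
    exact XX i k b (fun hk => clique (by rw [hk, add_zero])) (fun hk => one (S.X_complete_X i k hk))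
      fun hk => zero (fun h => hne i k hk (by injection h)) (S.X_anticomplete_X i k hk)
  · obtain ⟨k, rfl⟩ := hadd i j
    exact XY i k b (fun hk => one (S.X_complete_Y i k hk))
      fun hk => zero nofun (S.X_anticomplete_Y i k hk)
  · obtain ⟨k, rfl⟩ := hadd i j
    exact XZ i k b (fun hk => one (S.X_complete_Z i k hk))
      fun hk => zero nofun (S.X_anticomplete_Z i k hk)
  · exact one (S.X_complete_W i) ▸ XW i
  · obtain ⟨k, rfl⟩ := hadd j i
    exact comm (XY j k b (fun hk => one' (S.X_complete_Y j k hk))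
      fun hk => zero' nofun (S.X_anticomplete_Y j k hk))
  · obtain ⟨k, rfl⟩ := hadd i j
    have hY := S.Y_empty i ⟨u, hu⟩
    exact YY i k b (fun hk => clique (by rw [hk, add_zero])) (fun hk => one (S.Y_complete_Y i k hk))
      fun hk => empty (hY.1 k hk)
  · obtain ⟨k, rfl⟩ := hadd i j
    have hY := S.Y_empty i ⟨u, hu⟩
    exact YZ i k b (fun hk => one (S.Y_complete_Z i k hk))
      (fun hk => zero nofun (hk ▸ S.Y_anticomplete_Z i)) fun hk => empty (hY.2.1 k hk)
  · exact one (S.Y_complete_W i) ▸ YW i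
  · obtain ⟨k, rfl⟩ := hadd j i
    exact comm (XZ j k b (fun hk => one' (S.X_complete_Z j k hk))
      fun hk => zero' nofun (S.X_anticomplete_Z j k hk))
  · obtain ⟨k, rfl⟩ := hadd j i
    have hY := S.Y_empty j ⟨v, hv⟩
    exact comm (YZ j k b (fun hk => one' (S.Y_complete_Z j k hk))
      (fun hk => zero' nofun (hk ▸ S.Y_anticomplete_Z j)) fun hk => empty' (hY.2.1 k hk))
  · obtain ⟨k, rfl⟩ := hadd i j
    have hZ := S.Z_empty i ⟨u, hu⟩
    exact ZZ i k b (fun hk => clique (by rw [hk, add_zero])) (fun hk => one (S.Z_complete_Z i k hk))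
      (fun hk => empty (hk ▸ hZ.1)) fun hk => empty (hk ▸ hZ.2)
  · exact one (S.Z_complete_W i) ▸ ZW i
  · exact comm (one' (S.X_complete_W j) ▸ XW j)
  · exact comm (one' (S.Y_complete_W j) ▸ YW j)
  · exact comm (one' (S.Z_complete_W j) ▸ ZW j)
  · rw [clique rfl]; decide +kernel

theorem saucerRule_A : ∀ s < 23, 7 ≤ s → ∀ b, saucerRule 22 s b = true := by decide +kernel

theorem saucerRule_A_X_false : ∀ s < 7, saucerRule 22 s false = true := by decide +kernel

theorem IsSevenSaucerPartition.saucerRule_none (H : G.IsSevenSaucerPartition P A)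
    {q : Option SpecialPart} {u v : V} {b : Bool} (hu : u ∈ A) (hv : v ∈ saucerParts P A q)
    (hb : G.AdjOrEq u v ↔ b = true) : saucerRule 22 (saucerNum q) b = true := by
  rcases lt_or_ge (saucerNum q) 7 with hq | hq
  · rcases q with _ | i | i | i | _
    · exact absurd hq (by decide)
    · rw [H.eq_false (p := none) (q := some (X i)) hu hv hb nofun (H.A_anticomplete_X i)]
      exact saucerRule_A_X_false _ hq
    all_goals (simp only [saucerNum, num] at hq; omega)
  · exact saucerRule_A _ (saucerNum_lt q) hq b

theorem IsSevenSaucerPartition.exists_isSaucerLabeling (H : G.IsSevenSaucerPartition P A) :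
    ∃ c, G.IsSaucerLabeling c ∧ G.HasNestedCliquePartition {v | c v = 22} := by
  choose p hp using H.exists_part
  have hpart : ∀ {v q}, v ∈ saucerParts P A q ↔ p v = q := fun {v q} =>
    ⟨fun h => H.part_unique (hp v) h, fun h => h ▸ hp v⟩
  have hY : ∀ v, ∀ i < 7, saucerNum (p v) = 7 + i → v ∈ P (Y (i : ZMod 7)) := by
    intro v i hi hv
    have := hp v
    rcases hpv : p v with _ | j | j | j | _ <;> rw [hpv] at hv this <;>
      simp only [saucerNum, num] at hv <;> try omega
    · have := ZMod.val_lt j; omega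
    · have hji : j.val = i := by omega
      rw [← hji, ZMod.natCast_zmod_val]
      exact this
  have hZ : ∀ v, ∀ i < 7, saucerNum (p v) = 14 + i → v ∈ P (Z (i : ZMod 7)) := by
    intro v i hi hv
    have := hp v
    rcases hpv : p v with _ | j | j | j | _ <;> rw [hpv] at hv this <;>
      simp only [saucerNum, num] at hv <;> try omega
    · have := ZMod.val_lt j; omega
    · have := ZMod.val_lt j; omega
    · have hji : j.val = i := by omega
      rw [← hji, ZMod.natCast_zmod_val]
      exact this
  have hA : ∀ v, saucerNum (p v) = 22 ↔ v ∈ A := by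
    intro v
    change _ ↔ v ∈ saucerParts P A none
    rw [hpart]
    refine ⟨fun hv => ?_, fun hv => hv ▸ rfl⟩
    rcases hpv : p v with _ | q
    · rfl
    · rw [hpv] at hv
      exact absurd hv (num_lt q).ne
  have hmod : ∀ i k : ℕ, (((i + k) % 7 : ℕ) : ZMod 7) = (i : ZMod 7) + (k : ZMod 7) := by
    intro i k
    rw [ZMod.natCast_mod, Nat.cast_add]
  refine ⟨fun v => saucerNum (p v), ⟨fun v => saucerNum_lt _, ?_, ?_, ?_, ?_⟩, ?_⟩
  · intro i hi
    obtain ⟨v, hv⟩ := H.special.X_nonempty (i : ZMod 7)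
    refine ⟨v, ?_⟩
    rw [(hpart (q := some (X (i : ZMod 7)))).1 hv]
    exact ZMod.val_cast_of_lt hi
  · intro u v b hb
    change saucerRule (saucerNum (p u)) (saucerNum (p v)) b = true
    rcases hu : p u with _ | q
    · exact H.saucerRule_none (hpart.2 hu) (hp v) hb
    · rcases hv : p v with _ | q'
      · rw [saucerRule_comm _ (saucerNum_lt _) _ (saucerNum_lt _)]
        exact H.saucerRule_none (hpart.2 hv) (hpart.2 hu) (adjOrEq_comm.trans hb)
      · exact H.saucerRule_some (hpart.2 hu) (hpart.2 hv) hb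
  · intro i hi u v w hu hv hw
    have hv' := hY v _ (Nat.mod_lt _ (by norm_num)) hv
    have hw' := hY w _ (Nat.mod_lt _ (by norm_num)) hw
    rw [hmod] at hv' hw'
    rcases (H.special.Y_empty _ ⟨u, hY u i hi hu⟩).2.2 with h | h
    · exact (Set.eq_empty_iff_forall_notMem.1 h) v hv'
    · exact (Set.eq_empty_iff_forall_notMem.1 h) w hw'
  · intro i hi
    refine (H.A_anticomplete_Y_or (i : ZMod 7)).imp ?_ ?_
    · rintro h a y ha hy hay
      have hy' := hY y i hi hy
      have haA := (hA a).1 ha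
      rcases hay with rfl | hay
      · exact absurd (H.part_unique (p := none) (q := some _) haA hy') nofun
      · exact h haA hy' hay
    · intro h z hz
      have hz' := hZ z _ (Nat.mod_lt _ (by norm_num)) hz
      rw [hmod] at hz'
      exact (Set.eq_empty_iff_forall_notMem.1 h) z hz'
  · have : {v | saucerNum (p v) = 22} = A := Set.ext hA
    rw [this]
    exact H.A_nested

end SpecialPartition

theorem isSevenSaucer_iff [Finite V] (G : SimpleGraph V) :
    G.IsSevenSaucer ↔ G.AvoidsPatterns forbiddenPatterns ∧ G.Occurs 7 cycleSeven := by
  constructor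
  · rintro ⟨P, A, H⟩
    obtain ⟨c, h, hA⟩ := H.exists_isSaucerLabeling
    exact ⟨h.avoidsPatterns hA, h.occurs_cycleSeven⟩
  · rintro ⟨hG, ho⟩
    obtain ⟨c, h, hA⟩ := exists_isSaucerLabeling hG ho
    exact ⟨_, _, h.isSevenSaucerPartition hA⟩

/-! ### Tents: the rules and their verification -/

/-- The patterns that are avoided by tents. -/
def tentPatterns : List (ℕ × List ℕ) :=
  [(4, cycleFour), (6, twoPaths), (6, cycleSix), (7, cycleSeven)]

/-- The parts of a tent are numbered by `0, …, 13` in the order `A₀`, `A₁`, `B₀`, `B₁`, `B₂`, `B₃`,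
`C₁`, `C₂`, `C₃`, `F₂`, `F₃`, `W`, `Y`, `Z`. The value of `tentRule s t b` tells whether vertices of
the parts `s` and `t` may be adjacent or equal (`b = true`) or distinct and nonadjacent
(`b = false`). -/
noncomputable def tentRule (s t : ℕ) (b : Bool) : Bool :=
  bitOf (entry (Bool.rec
    -- The first list marks permitted nonadjacencies, the second permitted adjacencies. A bit set in
    -- both imposes no condition, a bit set in neither makes the two parts exclude each other.
    [12744, 12740, 12730, 12725, 13164, 13532, 12339, 8751, 9247, 8336, 8480, 12288, 10367, 16383]
    [3639, 3643, 3653, 3658, 3219, 2851, 4044, 7632, 7136, 11119, 11487, 16383, 6528, 11776] b) s) t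

/-- The traces on the graph `T₀` of the vertices of the parts of a tent. -/
def tentTraces : List ℕ := [55, 59, 69, 74, 147, 291, 460, 464, 480, 367, 223, 511, 384, 0]

theorem tent_one : ∀ m < 512, (∃ s < 14, tentTraces.getD s 0 = m) ∨
    hasPattern tentPatterns (hostBit 9 tentZero [m] [1]) 10 = true := by
  decide +kernel

theorem tent_two : ∀ s < 14, ∀ t < 14, ∀ b : Bool,
    tentRule s t b = true ∨ hasPattern tentPatterns (hostBit 9 tentZero
      [tentTraces.getD s 0, tentTraces.getD t 0] (pairMatrix b)) 11 = true := by
  decide +kernel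

theorem tent_Z_Z_Z : hasPattern tentPatterns (hostBit 9 tentZero
    [0, 0, 0] (tripleMatrix true false true)) 12 = true := by
  decide +kernel

theorem tentTraces_injective : ∀ s < 14, ∀ t < 14,
    tentTraces.getD s 0 = tentTraces.getD t 0 → s = t := by
  decide +kernel

theorem tentRule_comm : ∀ s < 14, ∀ t < 14, ∀ b, tentRule s t b = tentRule t s b := by
  decide +kernel

theorem tentRule_T0 : ∀ i < 9, ∀ j < 9, ∀ b, tentRule i j b = true → b = bitAt tentZero i j := by
  decide +kernel

/-- The outside neighbors of $Z$ form a clique, since $F_2$ and $F_3$ exclude each other and $W$ is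
complete to both. This yields the four-cycle that proves nestedness. -/
theorem tentRule_Z_true : ∀ s < 14, tentRule 13 s true = true → s ≠ 13 →
    s = 9 ∨ s = 10 ∨ s = 11 := by
  decide +kernel

/-- Two vertices of $Y$ can differ only on $W$. As $W$ is a clique, private neighbors would close a
four-cycle. -/
theorem tentRule_Y : ∀ s < 14, tentRule 12 s true = true → tentRule 12 s false = true →
    s = 11 := by
  decide +kernel

/-- The labels of the parts of a tent, without edges inside of `Y` and `Z`. -/
noncomputable def strictTentRule (s t : ℕ) (b : Bool) : Bool :=
  tentRule s t b && !(b && Nat.beq s t && Nat.ble 12 s)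

theorem labelable_tent_cycleFour :
    labelable (relRow strictTentRule 14) 14 cycleFour 4 0 (List.replicate 4 (2 ^ 14 - 1))
      = false := by
  decide +kernel

theorem labelable_tent_cycleSix :
    labelable (relRow strictTentRule 14) 14 cycleSix 6 0 (List.replicate 6 (2 ^ 14 - 1))
      = false := by
  decide +kernel

/-- Each path has a vertex outside $Z$, as $Z$ is a disjoint union of cliques. The numbers `a` and
`b` are the positions of such vertices, and the mask $2^{13}-1$ removes the label 13 of $Z$ there.
-/
theorem labelable_tent_twoPaths : ∀ a < 3, ∀ b < 3,
    labelable (relRow tentRule 14) 14 twoPaths 6 0 ((List.range 6).map fun i =>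
      if i = a ∨ i = b + 3 then 2 ^ 13 - 1 else 2 ^ 14 - 1) = false := by
  decide +kernel

/-! ### Labelings of tents -/

/-- The labeling `c` of the vertices of `G` by the numbers of the parts satisfies the conditions on
a tent. -/
structure IsTentLabeling (G : SimpleGraph V) (c : V → ℕ) : Prop where
  lt : ∀ v, c v < 14
  surj : ∀ i < 9, ∃ v, c v = i
  rule : G.ObeysRule c tentRule
  Y_nested : G.HasNestedOrdering {v | c v = 12}
  Z_nested : G.HasNestedCliquePartition {v | c v = 13}

section TentLabeling

variable {G : SimpleGraph V} {c : V → ℕ}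

/-- Adjacent pattern vertices are incomparable, whereas adjacent vertices inside $Y$ or inside $Z$
are comparable. So no edge of the pattern lies within $Y$ or $Z$, and the strict rule is obeyed. -/
theorem IsTentLabeling.labelable_cycle (h : G.IsTentLabeling c) {n : ℕ} {M : List ℕ} {f : ℕ → V}
    (hf : Realizes G.AdjOrEq f n (bitAt M))
    (hM : ∀ i < n, ∀ j < i, bitAt M j i = true → Incomparable M n j i) :
    labelable (relRow strictTentRule 14) 14 M n 0 (List.replicate n (2 ^ 14 - 1)) = true := by
  refine labelable_of_forall n 0 _ (by simp) (fun i => c (f i)) fun i hi =>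
    ⟨by rw [List.getD_eq_getElem _ _ (by simpa using hi), List.getElem_replicate,
        Nat.testBit_two_pow_sub_one, decide_eq_true_iff]; exact h.lt _, h.lt _, fun j hj => ?_⟩
  have hj' := hj.trans hi
  simp only [relRow, testBit_maskOf, Bool.and_eq_true, zero_add, decide_eq_true_iff,
    strictTentRule]
  refine ⟨h.lt _, h.rule _ _ _ (hf j hj' i hi), ?_⟩
  rw [Bool.not_eq_true', ← Bool.not_eq_true]
  simp only [Bool.and_eq_true, Nat.beq_eq, Nat.ble_eq]
  rintro ⟨⟨hb, heq⟩, h12⟩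
  have hadj := (hf j hj' i hi).2 hb
  have hnot := (hM i hi j hj hb).not_comparable hf hj' hi
  have hlt := h.lt (f j)
  obtain hc | hc : c (f j) = 12 ∨ c (f j) = 13 := by omega
  · exact hnot (h.Y_nested.comparable hc (heq.symm.trans hc))
  · exact hnot (h.Z_nested.comparable hc (heq.symm.trans hc) hadj)

theorem IsTentLabeling.avoidsPatterns (h : G.IsTentLabeling c) :
    G.AvoidsPatterns forbiddenPatterns := by
  simp only [AvoidsPatterns, forbiddenPatterns, List.forall_mem_cons]
  refine ⟨fun ho => ?_, fun ho => ?_, fun ho => ?_, by simp⟩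
  · obtain ⟨f, hf⟩ := ho.realizes (by decide) (by decide)
    have := h.labelable_cycle hf (by unfold Incomparable; decide)
    exact Bool.false_ne_true (labelable_tent_cycleFour.symm.trans this)
  · obtain ⟨f, hf⟩ := ho.realizes (by decide) (by decide)
    have key : ∀ p q r, p < 6 ∧ q < 6 ∧ r < 6 ∧ bitAt twoPaths p q = true ∧
        bitAt twoPaths q r = true ∧ bitAt twoPaths p r = false →
        c (f p) ≠ 13 ∨ c (f q) ≠ 13 ∨ c (f r) ≠ 13 := by
      rintro p q r ⟨hp, hq, hr, hpq, hqr, hpr⟩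
      by_contra! hcon
      have := h.Z_nested.trans hcon.1 hcon.2.1 hcon.2.2 ((hf p hp q hq).2 hpq)
        ((hf q hq r hr).2 hqr)
      rw [hf p hp r hr, hpr] at this
      simp at this
    obtain ⟨a, ha, hca⟩ : ∃ a < 3, c (f a) ≠ 13 := by
      rcases key 0 1 2 (by decide) with h | h | h
      exacts [⟨0, by norm_num, h⟩, ⟨1, by norm_num, h⟩, ⟨2, by norm_num, h⟩]
    obtain ⟨b, hb, hcb⟩ : ∃ b < 3, c (f (b + 3)) ≠ 13 := by
      rcases key 3 4 5 (by decide) with h | h | h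
      exacts [⟨0, by norm_num, h⟩, ⟨1, by norm_num, h⟩, ⟨2, by norm_num, h⟩]
    have := h.rule.labelable (N := 14) (fun i hi j hj => hf j (hj.trans hi) i hi)
      (cs := (List.range 6).map fun i => if i = a ∨ i = b + 3 then 2 ^ 13 - 1 else 2 ^ 14 - 1)
      (by simp) fun i hi => by
        refine ⟨h.lt _, ?_⟩
        have hlt := h.lt (f i)
        rw [List.getD_eq_getElem _ _ (by simpa using hi), List.getElem_map, List.getElem_range]
        split_ifs with hi'
        · rw [Nat.testBit_two_pow_sub_one, decide_eq_true_iff]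
          have : c (f i) ≠ 13 := by rcases hi' with rfl | rfl <;> assumption
          omega
        · rw [Nat.testBit_two_pow_sub_one, decide_eq_true_iff]
          exact hlt
    exact Bool.false_ne_true ((labelable_tent_twoPaths a ha b hb).symm.trans this)
  · obtain ⟨f, hf⟩ := ho.realizes (by decide) (by decide)
    have := h.labelable_cycle hf (by unfold Incomparable; decide)
    exact Bool.false_ne_true (labelable_tent_cycleSix.symm.trans this)

theorem IsTentLabeling.occurs_tentZero (h : G.IsTentLabeling c) : G.Occurs 9 tentZero := by
  have hex : ∀ i, ∃ v, i < 9 → c v = i := fun i => by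
    by_cases hi : i < 9
    · exact (h.surj i hi).imp fun v hv _ => hv
    · exact (h.surj 0 (by norm_num)).imp fun v _ hi' => absurd hi' hi
  choose x hx using hex
  refine ⟨x, fun i hi j hj => ?_⟩
  obtain ⟨b, hb⟩ := exists_bool_iff (G.AdjOrEq (x j) (x i))
  have := h.rule _ _ _ hb
  rw [hx i hi, hx j (hj.trans hi)] at this
  rw [hb, tentRule_T0 j (hj.trans hi) i hi b this]

theorem exists_isTentLabeling [Finite V] (hG : G.AvoidsPatterns tentPatterns)
    (ho : G.Occurs 9 tentZero) : ∃ c, G.IsTentLabeling c := by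
  obtain ⟨x, hx⟩ := ho.realizes (by decide) (by decide)
  have hex : ∀ v, ∃ s < 14, tentTraces.getD s 0 = G.trace x 9 v := fun v =>
    (tent_one _ (trace_lt G x 9 v)).resolve_right (by simp [hG.extend_one hx v])
  choose c hlt hc using hex
  have hrule : G.ObeysRule c tentRule := by
    intro u v b hb
    have := hG.extend_two hx hb
    rw [← hc u, ← hc v] at this
    exact (tent_two _ (hlt u) _ (hlt v) b).resolve_right fun h =>
      Bool.false_ne_true (this.symm.trans h)
  have hZ : ∀ a, c a = 13 → G.trace x 9 a = 0 := fun a ha => by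
    rw [← hc a, ha]; rfl
  have htrans : ∀ u ∈ {v | c v = 13}, ∀ v ∈ {v | c v = 13}, ∀ w ∈ {v | c v = 13},
      G.AdjOrEq u v → G.AdjOrEq v w → G.AdjOrEq u w := by
    intro u hu v hv w hw huv hvw
    by_contra huw
    have := hG.extend_three hx (iff_of_true huv rfl) (iff_of_false huw Bool.false_ne_true)
      (iff_of_true hvw rfl)
    rw [hZ u hu, hZ v hv, hZ w hw, tent_Z_Z_Z] at this
    simp at this
  have hfour : (4, cycleFour) ∈ tentPatterns := by simp [tentPatterns]
  refine ⟨c, hlt, fun i hi => ⟨x i, ?_⟩, hrule, ?_, ?_⟩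
  · refine tentTraces_injective _ (hlt _) _ (by omega) ?_
    rw [hc, trace_base hx hi]
    · interval_cases i <;> rfl
    · interval_cases i <;> decide
  · refine hasNestedOrdering_of_comparable _ fun a ha a' ha' => ?_
    replace ha : c a = 12 := ha
    replace ha' : c a' = 12 := ha'
    have haa : G.AdjOrEq a a' := hrule.adjOrEq (by rw [ha, ha']; decide +kernel)
    refine comparable_of_forall fun w w' haw haw' hww => ?_
    by_contra hn
    have hw : c w = 11 := tentRule_Y _ (hlt w)
      (ha ▸ hrule.apply_true haw) (ha' ▸ hrule.apply_false haw')
    have hw' : c w' = 11 := tentRule_Y _ (hlt w')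
      (ha' ▸ hrule.apply_true hww) (ha ▸ hrule.apply_false hn)
    have hwadj : G.AdjOrEq w w' := hrule.adjOrEq (by rw [hw, hw']; decide +kernel)
    exact haw' (hG.four_cycle hfour haw hwadj hww.symm haa.symm hn).symm
  · refine hasNestedCliquePartition_of htrans fun a ha a' ha' haa => ?_
    refine comparable_of_forall fun w w' haw haw' hww => ?_
    by_contra hn
    have hw : c w ≠ 13 := fun hw => haw' (htrans a' ha' a ha w hw haa.symm haw)
    have hw' : c w' ≠ 13 := fun hw' => hn (htrans a ha a' ha' w' hw' haa hww)
    replace ha : c a = 13 := ha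
    replace ha' : c a' = 13 := ha'
    have h1 := tentRule_Z_true _ (hlt w) (ha ▸ hrule.apply_true haw) hw
    have h2 := tentRule_Z_true _ (hlt w') (ha' ▸ hrule.apply_true hww) hw'
    have hwadj : G.AdjOrEq w w' := by
      by_contra hcon
      have h3 := hrule.apply_false hcon
      rcases h1 with h1 | h1 | h1 <;> rcases h2 with h2 | h2 | h2 <;> rw [h1, h2] at h3 <;>
        revert h3 <;> decide +kernel
    exact haw' (hG.four_cycle hfour haw hwadj hww.symm haa.symm hn).symm

end TentLabeling

/-! ### Passing between tent partitions and labelings. -/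

namespace TentPart

/-- The numbers of the parts of a tent partition. -/
def num : TentPart → ℕ
  | A0 => 0
  | A1 => 1
  | B0 => 2
  | B1 => 3
  | B2 => 4
  | B3 => 5
  | C1 => 6
  | C2 => 7
  | C3 => 8
  | F2 => 9
  | F3 => 10
  | W => 11
  | Y => 12
  | Z => 13

theorem num_lt (p : TentPart) : p.num < 14 := by cases p <;> decide

theorem exists_num_eq {n : ℕ} (hn : n < 14) : ∃ p : TentPart, p.num = n := by
  interval_cases n
  exacts [⟨A0, rfl⟩, ⟨A1, rfl⟩, ⟨B0, rfl⟩, ⟨B1, rfl⟩, ⟨B2, rfl⟩, ⟨B3, rfl⟩, ⟨C1, rfl⟩, ⟨C2, rfl⟩,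
    ⟨C3, rfl⟩, ⟨F2, rfl⟩, ⟨F3, rfl⟩, ⟨W, rfl⟩, ⟨Y, rfl⟩, ⟨Z, rfl⟩]

theorem num_injective : Function.Injective num := by
  intro p q h
  cases p <;> cases q <;> first | rfl | exact absurd h (by decide)

end TentPart

section TentPartition

open TentPart

variable {G : SimpleGraph V} {c : V → ℕ} {P : TentPart → Set V}

theorem IsTentLabeling.isTentPartition (h : G.IsTentLabeling c) :
    G.IsTentPartition fun p => {v | c v = p.num} where
  disjoint p q hpq := Set.disjoint_left.2 fun v hp hq =>
    hpq (num_injective ((show c v = _ from hp).symm.trans hq))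
  union := Set.eq_univ_of_forall fun v => by
    obtain ⟨p, hp⟩ := exists_num_eq (h.lt v)
    exact Set.mem_iUnion.2 ⟨p, hp.symm⟩
  ABC_nonempty := by
    rintro p (rfl | rfl | rfl | rfl | rfl | rfl | rfl | rfl | rfl) <;>
      exact h.surj _ (by decide)
  clique := by
    rintro p (rfl | rfl | rfl | rfl | rfl | rfl | rfl | rfl | rfl | rfl | rfl | rfl | rfl) <;>
      exact h.rule.isClique (by decide +kernel)
  FY_empty := by
    rintro p (rfl | rfl | rfl) q (rfl | rfl | rfl) hne <;>
      first
      | exact absurd rfl hne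
      | exact (Set.eq_empty_or_nonempty _).imp_right fun hp =>
          h.rule.eq_empty hp (by decide +kernel)
  A0_complete_A1 := h.rule.isCompleteBetween (by decide +kernel)
  A0_complete := by
    rintro p (rfl | rfl | rfl) <;> exact h.rule.isCompleteBetween (by decide +kernel)
  A0_anticomplete := by
    rintro p (rfl | rfl | rfl | rfl) <;> exact h.rule.isAnticompleteBetween (by decide +kernel)
  A1_complete := by
    rintro p (rfl | rfl | rfl) <;> exact h.rule.isCompleteBetween (by decide +kernel)
  A1_anticomplete := by
    rintro p (rfl | rfl | rfl | rfl) <;> exact h.rule.isAnticompleteBetween (by decide +kernel)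
  B_anticomplete := by
    rintro p (rfl | rfl | rfl | rfl) q (rfl | rfl | rfl | rfl) hne <;>
      first
      | exact absurd rfl hne
      | exact h.rule.isAnticompleteBetween (by decide +kernel)
  C_complete := by
    rintro p (rfl | rfl | rfl) q (rfl | rfl | rfl) hne <;>
      first
      | exact absurd rfl hne
      | exact h.rule.isCompleteBetween (by decide +kernel)
  C1_complete := by
    rintro p (rfl | rfl) <;> exact h.rule.isCompleteBetween (by decide +kernel)
  C1_anticomplete := by
    rintro p (rfl | rfl) <;> exact h.rule.isAnticompleteBetween (by decide +kernel)
  C2_complete := h.rule.isCompleteBetween (by decide +kernel)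
  C2_anticomplete := by
    rintro p (rfl | rfl | rfl) <;> exact h.rule.isAnticompleteBetween (by decide +kernel)
  C3_complete := h.rule.isCompleteBetween (by decide +kernel)
  C3_anticomplete := by
    rintro p (rfl | rfl | rfl) <;> exact h.rule.isAnticompleteBetween (by decide +kernel)
  F2_complete := by
    rintro p (rfl | rfl | rfl | rfl | rfl | rfl | rfl) <;>
      exact h.rule.isCompleteBetween (by decide +kernel)
  F2_anticomplete := by
    rintro p (rfl | rfl) <;> exact h.rule.isAnticompleteBetween (by decide +kernel)
  F3_complete := by
    rintro p (rfl | rfl | rfl | rfl | rfl | rfl | rfl) <;>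
      exact h.rule.isCompleteBetween (by decide +kernel)
  F3_anticomplete := by
    rintro p (rfl | rfl) <;> exact h.rule.isAnticompleteBetween (by decide +kernel)
  W_complete := by
    rintro p (rfl | rfl | rfl | rfl | rfl | rfl | rfl | rfl | rfl | rfl | rfl) <;>
      exact h.rule.isCompleteBetween (by decide +kernel)
  Y_complete := by
    rintro p (rfl | rfl) <;> exact h.rule.isCompleteBetween (by decide +kernel)
  Y_anticomplete := by
    rintro p (rfl | rfl | rfl | rfl | rfl | rfl | rfl) <;>
      exact h.rule.isAnticompleteBetween (by decide +kernel)
  Z_anticomplete := by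
    rintro p (rfl | rfl | rfl | rfl | rfl | rfl | rfl | rfl | rfl | rfl) <;>
      exact h.rule.isAnticompleteBetween (by decide +kernel)
  Y_nested := h.Y_nested
  Z_nested := h.Z_nested

theorem IsTentPartition.part_unique (H : G.IsTentPartition P) {v : V} {p q : TentPart}
    (hp : v ∈ P p) (hq : v ∈ P q) : p = q := by
  by_contra hne
  exact Set.disjoint_left.1 (H.disjoint hne) hp hq

theorem IsTentPartition.tentRule_of_le (H : G.IsTentPartition P) {p q : TentPart} {u v : V}
    {b : Bool} (hu : u ∈ P p) (hv : v ∈ P q) (hb : G.AdjOrEq u v ↔ b = true)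
    (hpq : p.num ≤ q.num) : tentRule p.num q.num b = true := by
  have clique : p = q → G.IsClique (P q) → tentRule p.num q.num true = true →
      tentRule p.num q.num b = true := fun h1 h2 h3 => by
    rwa [hb.1 (isClique_iff_adjOrEq.1 h2 u (h1 ▸ hu) v hv)]
  have one : G.IsCompleteBetween (P p) (P q) → tentRule p.num q.num true = true →
      tentRule p.num q.num b = true := fun h1 h2 => by
    rwa [hb.1 (Or.inr (h1 hu hv))]
  have one' : G.IsCompleteBetween (P q) (P p) → tentRule p.num q.num true = true →
      tentRule p.num q.num b = true := fun h1 h2 => by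
    rwa [hb.1 (Or.inr (h1 hv hu).symm)]
  have zero : p ≠ q → G.IsAnticompleteBetween (P p) (P q) → tentRule p.num q.num false = true →
      tentRule p.num q.num b = true := fun h1 h2 h3 => by
    have hf : b = false := by
      rw [← Bool.not_eq_true, ← hb]
      rintro (rfl | huv)
      · exact h1 (H.part_unique hu hv)
      · exact h2 hu hv huv
    rwa [hf]
  have zero' : p ≠ q → G.IsAnticompleteBetween (P q) (P p) →
      tentRule p.num q.num false = true → tentRule p.num q.num b = true := fun h1 h2 h3 =>
    zero h1 (fun _ hs _ ht hst => h2 ht hs hst.symm) h3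
  have free : (∀ b, tentRule p.num q.num b = true) → tentRule p.num q.num b = true :=
    fun h => h b
  have empty : P p = ∅ ∨ P q = ∅ → tentRule p.num q.num b = true := by
    rintro (h | h)
    · simp [h] at hu
    · simp [h] at hv
  -- Each ordered pair of parts is settled by one clause of the definition. The primed variants
  -- serve the clauses stated from the part with the larger number, and `free` the pairs without
  -- condition.
  cases p <;> cases q <;>
    first
    | exact absurd hpq (by decide)
    | (refine clique rfl (H.clique _ ?_) ?_ <;> first | (simp; done) | decide +kernel)
    | exact free (by decide +kernel)
    | exact one H.A0_complete_A1 (by decide +kernel)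
    | (refine one (H.A0_complete _ ?_) ?_ <;> first | (simp; done) | decide +kernel)
    | (refine zero ?_ (H.A0_anticomplete _ ?_) ?_ <;> first | (simp; done) | decide +kernel)
    | (refine one (H.A1_complete _ ?_) ?_ <;> first | (simp; done) | decide +kernel)
    | (refine zero ?_ (H.A1_anticomplete _ ?_) ?_ <;> first | (simp; done) | decide +kernel)
    | (refine zero ?_ (H.B_anticomplete ?_ ?_ ?_) ?_ <;> first | (simp; done) | decide +kernel)
    | (refine one (H.C_complete ?_ ?_ ?_) ?_ <;> first | (simp; done) | decide +kernel)
    | (refine one' (H.C1_complete _ ?_) ?_ <;> first | (simp; done) | decide +kernel)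
    | (refine zero' ?_ (H.C1_anticomplete _ ?_) ?_ <;> first | (simp; done) | decide +kernel)
    | exact one' H.C2_complete (by decide +kernel)
    | (refine zero' ?_ (H.C2_anticomplete _ ?_) ?_ <;> first | (simp; done) | decide +kernel)
    | exact one' H.C3_complete (by decide +kernel)
    | (refine zero' ?_ (H.C3_anticomplete _ ?_) ?_ <;> first | (simp; done) | decide +kernel)
    | (refine one' (H.F2_complete _ ?_) ?_ <;> first | (simp; done) | decide +kernel)
    | (refine zero' ?_ (H.F2_anticomplete _ ?_) ?_ <;> first | (simp; done) | decide +kernel)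
    | (refine one' (H.F3_complete _ ?_) ?_ <;> first | (simp; done) | decide +kernel)
    | (refine zero' ?_ (H.F3_anticomplete _ ?_) ?_ <;> first | (simp; done) | decide +kernel)
    | (refine one' (H.W_complete _ ?_) ?_ <;> first | (simp; done) | decide +kernel)
    | (refine one' (H.Y_complete _ ?_) ?_ <;> first | (simp; done) | decide +kernel)
    | (refine zero' ?_ (H.Y_anticomplete _ ?_) ?_ <;> first | (simp; done) | decide +kernel)
    | (refine zero' ?_ (H.Z_anticomplete _ ?_) ?_ <;> first | (simp; done) | decide +kernel)
    | (refine empty (H.FY_empty ?_ ?_ ?_) <;> simp)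

theorem IsTentPartition.exists_isTentLabeling (H : G.IsTentPartition P) :
    ∃ c, G.IsTentLabeling c := by
  have hex : ∀ v, ∃ p, v ∈ P p := fun v => by
    rw [← Set.mem_iUnion, H.union]
    trivial
  choose p hp using hex
  have hset : ∀ q : TentPart, {v | (p v).num = q.num} = P q := by
    intro q
    ext v
    exact ⟨fun hv => num_injective hv ▸ hp v, fun hv => congrArg num (H.part_unique (hp v) hv)⟩
  refine ⟨fun v => (p v).num, fun v => num_lt _, ?_, ?_, ?_, ?_⟩
  · intro i hi
    obtain ⟨q, rfl⟩ := exists_num_eq (show i < 14 by omega)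
    have hq : (P q).Nonempty := by
      refine H.ABC_nonempty q ?_
      cases q <;> first | exact absurd hi (by decide) | simp
    rw [← hset q] at hq
    exact hq
  · intro u v b hb
    rcases le_total (p u).num (p v).num with h | h
    · exact H.tentRule_of_le (hp u) (hp v) hb h
    · change tentRule (p u).num (p v).num b = true
      rw [tentRule_comm _ (num_lt _) _ (num_lt _)]
      exact H.tentRule_of_le (hp v) (hp u) (adjOrEq_comm.trans hb) h
  · exact (hset Y).symm ▸ H.Y_nested
  · exact (hset Z).symm ▸ H.Z_nested

end TentPartition

/-! ### The two cases of the equivalence. -/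

theorem IsTent.avoidsPatterns_and_occurs {G : SimpleGraph V} (h : G.IsTent) :
    G.AvoidsPatterns forbiddenPatterns ∧ G.Occurs 9 tentZero := by
  obtain ⟨P, H⟩ := h
  obtain ⟨c, hc⟩ := H.exists_isTentLabeling
  exact ⟨hc.avoidsPatterns, hc.occurs_tentZero⟩

theorem isTent_of_avoidsPatterns [Finite V] {G : SimpleGraph V}
    (hG : G.AvoidsPatterns forbiddenPatterns) (h7 : ¬ G.Occurs 7 cycleSeven)
    (ho : G.Occurs 9 tentZero) : G.IsTent := by
  have hG' : G.AvoidsPatterns tentPatterns := by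
    simp only [AvoidsPatterns, forbiddenPatterns, tentPatterns, List.forall_mem_cons] at hG ⊢
    exact ⟨hG.1, hG.2.1, hG.2.2.1, h7, by simp⟩
  obtain ⟨c, hc⟩ := exists_isTentLabeling hG' ho
  exact ⟨_, hc.isTentPartition⟩

end SimpleGraph

theorem mainTheorem3 {V : Type*} [Finite V] (G : SimpleGraph V) :
    ((¬ SimpleGraph.twoP3 ⊴ G ∧ ¬ SimpleGraph.cycleGraph 4 ⊴ G ∧ ¬ SimpleGraph.cycleGraph 6 ⊴ G) ∧
        (SimpleGraph.cycleGraph 7 ⊴ G ∨ SimpleGraph.graphT0 ⊴ G)) ↔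
      (G.IsSevenSaucer ∨ G.IsTent) := by
  rw [← SimpleGraph.avoidsPatterns_forbiddenPatterns, ← SimpleGraph.occurs_cycleSeven,
    ← SimpleGraph.occurs_tentZero, SimpleGraph.isSevenSaucer_iff]
  constructor
  · rintro ⟨hG, ho⟩
    -- An induced $C_7$ already gives a saucer. In the remaining case $C_7$ may be added to the
    -- forbidden graphs, as in `tentPatterns`.
    by_cases h7 : G.Occurs 7 SimpleGraph.cycleSeven
    · exact Or.inl ⟨hG, h7⟩
    · exact Or.inr (SimpleGraph.isTent_of_avoidsPatterns hG h7 (ho.resolve_left h7))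
  · rintro (⟨hG, h7⟩ | hT)
    · exact ⟨hG, Or.inl h7⟩
    · have h := hT.avoidsPatterns_and_occurs
      exact ⟨h.1, Or.inr h.2⟩
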